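/- Let $n,k\ge 0$ be integers and $\Lambda=\{\lambda=(l_1,\dots,l_n)\in\mathbb Z_{\ge0}^n : \sum_a l_a=k\}$. Let $\mathbb C_{n,k}[z]$ be the set of $n\times n$ matrices with entries in $\mathbb C[z]$ whose determinant has degree exactly $k$, and let $$\mathcal M=\mathbb C_{n,k}[z]/\!\sim,\qquad D\sim D'\iff D'=VD\ \text{ for some } V\in\mathbb C_{n,0}[z].$$ Let $\widetilde{\mathcal M}$ be the quotient, with the quotient topology, of the space of pairs $(Z,\Psi)\in M_{k\times k}(\mathbb C)\times M_{n\times k}(\mathbb C)$ fixed by no $g\ne 1$ in $GL(k,\mathbb C)$, by the action $(Z,\Psi)\mapsto(g^{-1}Zg,\Psi g)$ of $GL(k,\mathbb C)$. For $\lambda\in\Lambda$ and $T=(T^{ab}_m)_{1\le a,b\le n,\,1\le m\le l_b}\in\mathbb C^{nk}$ put $$D_\lambda(T)=\mathrm{diag}(z^{l_1},\dots,z^{l_n})-(P^{ab}),\qquad P^{ab}=\sum_{m=1}^{l_b}T^{ab}_m z^{m-1}.$$ Split $k$ into blocks of lengths $l_1,\dots,l_n$, and let $(Z_\lambda(T),\Psi_\lambda(T))$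 be the pair such that, for each $a$, the $a$-th row of $\Psi_\lambda(T)$ placed on top of the $a$-th block of rows of $Z_\lambda(T)$ is the $(l_a+1)\times k$ matrix whose first $l_a$ rows are the unit row vectors of the $a$-th block and whose last row is $(T^{a1}_1,\dots,T^{a1}_{l_1},\dots,T^{an}_1,\dots,T^{an}_{l_n})$. Let $J_\lambda(T)$ be the $n\times k$ matrix whose entry in row $a$ and position $p$ of the $b$-th block is the polynomial part of $D_\lambda(T)_{ab}/z^{p}$. Give $\mathcal M$ the topology glued from the maps $T\mapsto[D_\lambda(T)]$: a subset is open iff its preimage in $\mathbb C^{nk}$ is open for every $\lambda\in\Lambda$. Then the following hold. 1. (Complex manifolds.) $\mathcal M$ and $\widetilde{\mathcal M}$ are Hausdorff and second countable. For every $\lambda$ the maps $T\mapsto[D_\lambda(T)]$ and $T\mapsto[(Z_\lambda(T),\Psi_\lambda(T))]$ are well-defined homeomorphisms of $\mathbb C^{nk}$ onto open sets $\mathcal M_\lambda\subseteq\mathcal M$ and $\widetilde{\mathcal M}_\lambda\subseteq\widetilde{\mathcal M}$. Their inverses, $\lambda\in\Lambda$, form holomorphic atlases of $\mathcal M$ and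 $\widetilde{\mathcal M}$. 2. (Strata.) $\mathcal M=\bigsqcup_{\lambda\in\Lambda}\mathcal M^{\rm tri}_\lambda$, where $\mathcal M^{\rm tri}_\lambda$ is the set of classes of matrices $\mathrm{diag}(z^{l_1},\dots,z^{l_n})-P$ with $P$ upper triangular and $\deg P_{ab}<l_b$; and $\mathcal M^{\rm tri}_\lambda$ is the subset $\{T^{ab}_m=0\text{ for }a>b\}$ of $\mathcal M_\lambda$. Likewise $\widetilde{\mathcal M}=\bigsqcup_{\lambda\in\Lambda}\widetilde{\mathcal M}^{\rm tri}_\lambda$, where $\widetilde{\mathcal M}^{\rm tri}_\lambda$ is the set of classes $[(Z,\Psi)]$ with $\dim\widetilde{\mathcal V}_a-\dim\widetilde{\mathcal V}_{a-1}=l_a$ for all $a$, $\widetilde{\mathcal V}_a$ being the span of the rows $1,\dots,a$ of all the matrices $\Psi Z^p$, $p\ge0$; and $\widetilde{\mathcal M}^{\rm tri}_\lambda$ is the subset $\{T^{ab}_m=0\text{ for }a<b\}$ of $\widetilde{\mathcal M}_\lambda$. 3. (Equivalence.) There is a biholomorphic map $\Phi:\mathcal M\to\widetilde{\mathcal M}$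 such that $\Phi([D])=[(Z,\Psi)]$ if and only if there is an $n\times k$ polynomial matrix $J(z)$ with $$D(z)\Psi=J(z)(z\mathbf 1_k-Z).$$ It is the only map $\mathcal M\to\widetilde{\mathcal M}$ given by this relation. For $D\in\mathbb C_{n,k}[z]$, the columns of any such $J$ form a basis of the space of polynomial column vectors $j$ with $D(z)^{-1}j(z)=O(z^{-1})$ as $z\to\infty$, and conversely, for every $J$ whose columns form such a basis there is exactly one pair $(Z,\Psi)$ with free action satisfying the relation. For all $\lambda$ and $T$ one has $D_\lambda(T)\Psi_\lambda(T)=J_\lambda(T)(z\mathbf 1_k-Z_\lambda(T))$, so that $\Phi([D_\lambda(T)])=[(Z_\lambda(T),\Psi_\lambda(T))]$, i.e. $\Phi$ maps $\mathcal M_\lambda$ onto $\widetilde{\mathcal M}_\lambda$ and is the identity in the coordinates $T$. -/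

import Mathlib

open Polynomial Set
open scoped Manifold ContDiff

noncomputable section

namespace HalfADHM

/-! ## The index set and the coordinate space -/

/-- Tuples `(l_1, …, l_n)` of non-negative integers with `l_1 + ⋯ + l_n = k`. -/
abbrev Idx (n k : ℕ) : Type := {l : Fin n → ℕ // ∑ a, l a = k}

/-- The position of the `m`-th entry of the `b`-th block (of length `l_b`) among `k` entries. -/
def Idx.pos {n k : ℕ} (l : Idx n k) : (Σ b : Fin n, Fin (l.1 b)) ≃ Fin k :=
  finSigmaFinEquiv.trans (finCongr l.2)

/-- The coordinate space `ℂ^{nk}`.  Relative to `l : Idx n k`, the coordinate `T^{ab}_{m+1}`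
(`0 ≤ m < l_b`) of a point `T` is `T a (l.pos ⟨b, m⟩)`. -/
abbrev Coord (n k : ℕ) : Type := Fin n → Fin k → ℂ

/-! ## The moduli space of polynomial matrices -/

/-- `n × n` matrices with polynomial entries whose determinant has degree exactly `k`
(so for `k = 0` the determinant is a nonzero constant). -/
abbrev PolyMat (n k : ℕ) : Type :=
  {D : Matrix (Fin n) (Fin n) ℂ[X] // D.det.degree = (k : WithBot ℕ)}

/-- `D' ∼ D` iff `D' = V D` with `V` a polynomial matrix of nonzero constant determinant. -/
def VEquiv {n k : ℕ} (D D' : PolyMat n k) : Prop :=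
  ∃ V : PolyMat n 0, D'.1 = V.1 * D.1

lemma vEquiv_equivalence (n k : ℕ) : Equivalence (@VEquiv n k) where
  refl D := ⟨⟨1, by simp⟩, by simp⟩
  symm := by
    rintro D D' ⟨V, hV⟩
    have hu : IsUnit V.1.det := by
      rw [Polynomial.isUnit_iff_degree_eq_zero]; simpa using V.2
    refine ⟨⟨V.1⁻¹, ?_⟩, ?_⟩
    · have h := Matrix.isUnit_nonsing_inv_det V.1 hu
      rw [Polynomial.isUnit_iff_degree_eq_zero] at h; simpa using h
    · rw [hV, ← Matrix.mul_assoc, Matrix.nonsing_inv_mul _ hu, Matrix.one_mul]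
  trans := by
    rintro D D' D'' ⟨V, hV⟩ ⟨W, hW⟩
    refine ⟨⟨W.1 * V.1, ?_⟩, by rw [hW, hV, Matrix.mul_assoc]⟩
    rw [Matrix.det_mul, Polynomial.degree_mul, W.2, V.2]; simp

instance vSetoid (n k : ℕ) : Setoid (PolyMat n k) := ⟨VEquiv, vEquiv_equivalence n k⟩

/-- The moduli space `𝓜` of polynomial matrices modulo left multiplication. -/
def ModM (n k : ℕ) : Type := Quotient (vSetoid n k)

/-- The class `[D]` of a polynomial matrix. -/
def ModM.mk {n k : ℕ} (D : PolyMat n k) : ModM n k := Quotient.mk _ D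

/-- The matrix `D_λ(z) = diag(z^{l_1}, …, z^{l_n}) - P`, `P^{ab} = ∑_{m=1}^{l_b} T^{ab}_m z^{m-1}`. -/
def patchMat {n k : ℕ} (l : Idx n k) (T : Coord n k) : Matrix (Fin n) (Fin n) ℂ[X] :=
  Matrix.diagonal (fun a => X ^ l.1 a) -
    Matrix.of fun a b => ∑ m : Fin (l.1 b), C (T a (l.pos ⟨b, m⟩)) * X ^ (m : ℕ)

lemma coeff_prod_of_degree_le {ι : Type*} (s : Finset ι) (f : ι → ℂ[X]) (d : ι → ℕ)
    (h : ∀ i ∈ s, (f i).natDegree ≤ d i) :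
    (∏ i ∈ s, f i).coeff (∑ i ∈ s, d i) = ∏ i ∈ s, (f i).coeff (d i) := by
  classical
  induction s using Finset.induction_on with
  | empty => simp
  | insert a s ha ih =>
    have h2 : ∀ i ∈ s, (f i).natDegree ≤ d i := fun i hi => h i (Finset.mem_insert_of_mem hi)
    rw [Finset.prod_insert ha, Finset.sum_insert ha, Finset.prod_insert ha, ← ih h2]
    exact coeff_mul_add_eq_of_natDegree_le (h a (Finset.mem_insert_self a s))
      ((natDegree_prod_le s f).trans (Finset.sum_le_sum h2))

lemma patchMat_sum_degree {n k : ℕ} (l : Idx n k) (T : Coord n k) (a b : Fin n) :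
    (∑ m : Fin (l.1 b), C (T a (l.pos ⟨b, m⟩)) * X ^ (m : ℕ)).degree < (l.1 b : WithBot ℕ) := by
  rw [Polynomial.degree_lt_iff_coeff_zero]
  intro j hj
  rw [Polynomial.finsetSum_coeff]
  refine Finset.sum_eq_zero fun m _ => ?_
  rw [Polynomial.coeff_C_mul_X_pow, if_neg]
  have := m.2
  omega

lemma patchMat_det_degree {n k : ℕ} (l : Idx n k) (T : Coord n k) :
    (patchMat l T).det.degree = (k : WithBot ℕ) := by
  have hS := patchMat_sum_degree l T
  have hdeg : ∀ a b, (patchMat l T a b).natDegree ≤ l.1 b := by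
    intro a b
    refine natDegree_le_iff_degree_le.2 ?_
    refine (degree_sub_le _ _).trans (max_le ?_ (hS a b).le)
    rw [Matrix.diagonal_apply]
    split_ifs with h
    · subst h; simp
    · simp
  have hco : ∀ a b, (patchMat l T a b).coeff (l.1 b) = (1 : Matrix (Fin n) (Fin n) ℂ) a b := by
    intro a b
    have h0 : (patchMat l T a b) = Matrix.diagonal (fun a => (X : ℂ[X]) ^ l.1 a) a b -
      ∑ m : Fin (l.1 b), C (T a (l.pos ⟨b, m⟩)) * X ^ (m : ℕ) := rfl
    rw [h0, coeff_sub, coeff_eq_zero_of_degree_lt (hS a b), sub_zero, Matrix.diagonal_apply,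
      Matrix.one_apply]
    split_ifs with h
    · subst h; simp
    · simp
  have hprod : ∀ σ : Equiv.Perm (Fin n), (∏ i, patchMat l T (σ i) i).natDegree ≤ k := by
    intro σ
    exact ((natDegree_prod_le _ _).trans (Finset.sum_le_sum fun i _ => hdeg _ _)).trans l.2.le
  have hle : (patchMat l T).det.natDegree ≤ k := by
    rw [Matrix.det_apply]
    refine natDegree_sum_le_of_forall_le _ _ fun σ _ => ?_
    exact (natDegree_smul_le _ _).trans (hprod σ)
  have hc : (patchMat l T).det.coeff k = 1 := by
    rw [Matrix.det_apply, finsetSum_coeff,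
      ← Matrix.det_one (n := Fin n) (R := ℂ), Matrix.det_apply]
    refine Finset.sum_congr rfl fun σ _ => ?_
    have h3 := coeff_prod_of_degree_le Finset.univ (fun i => patchMat l T (σ i) i) l.1
      (fun i _ => hdeg _ _)
    rw [l.2] at h3
    rw [coeff_smul, h3]
    simp only [hco]
  exact le_antisymm (natDegree_le_iff_degree_le.1 hle)
    (le_degree_of_ne_zero (by rw [hc]; exact one_ne_zero))

/-- The inverse of the chart `φ_λ` of `𝓜`: the class of `D_λ` with coefficients `T`. -/
def paramM {n k : ℕ} (l : Idx n k) (T : Coord n k) : ModM n k :=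
  ModM.mk ⟨patchMat l T, patchMat_det_degree l T⟩

/-- The topology of `𝓜`, glued from the coordinate patches: a set is open iff its preimage in
each coordinate space `ℂ^{nk}` is open. -/
instance (n k : ℕ) : TopologicalSpace (ModM n k) :=
  ⨆ l : Idx n k, TopologicalSpace.coinduced (paramM l) inferInstance

/-- The upper triangular form `diag(z^{l_1}, …, z^{l_n}) - P` with `P` upper triangular and
`deg P_{ab} < l_b`. -/
def IsTri {n : ℕ} (l : Fin n → ℕ) (D : Matrix (Fin n) (Fin n) ℂ[X]) : Prop :=
  ∃ P : Matrix (Fin n) (Fin n) ℂ[X], D = Matrix.diagonal (fun a => X ^ l a) - P ∧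
    (∀ a b, b < a → P a b = 0) ∧ ∀ a b, (P a b).degree < (l b : WithBot ℕ)

/-- The triangular stratum of `𝓜` with label `λ`. -/
def triM {n k : ℕ} (l : Idx n k) : Set (ModM n k) :=
  {x | ∃ D : PolyMat n k, IsTri l.1 D.1 ∧ ModM.mk D = x}

/-! ## The moduli space of half-ADHM data -/

/-- Pairs `(Z, Ψ)` of a `k × k` and an `n × k` matrix. -/
abbrev Data (n k : ℕ) : Type := Matrix (Fin k) (Fin k) ℂ × Matrix (Fin n) (Fin k) ℂ

/-- The action `(Z, Ψ) ↦ (g⁻¹ Z g, Ψ g)` of `GL(k, ℂ)`. -/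
def gaugeAct {n k : ℕ} (g : GL (Fin k) ℂ) (x : Data n k) : Data n k :=
  ((↑g⁻¹ : Matrix (Fin k) (Fin k) ℂ) * x.1 * (g : Matrix (Fin k) (Fin k) ℂ),
    x.2 * (g : Matrix (Fin k) (Fin k) ℂ))

/-- Pairs `(Z, Ψ)` on which the action is free, i.e. fixed by no `g ≠ 1`, as a subspace of the
vector space of all pairs. -/
abbrev FreeData (n k : ℕ) : Type :=
  {x : Data n k // ∀ g : GL (Fin k) ℂ, gaugeAct g x = x → g = 1}

/-- Two pairs are equivalent iff they lie in one orbit. -/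
def GEquiv {n k : ℕ} (x y : FreeData n k) : Prop :=
  ∃ g : GL (Fin k) ℂ, y.1 = gaugeAct g x.1

lemma gaugeAct_one {n k : ℕ} (x : Data n k) : gaugeAct 1 x = x := by
  simp [gaugeAct]

lemma gaugeAct_gaugeAct {n k : ℕ} (g h : GL (Fin k) ℂ) (x : Data n k) :
    gaugeAct h (gaugeAct g x) = gaugeAct (g * h) x := by
  simp only [gaugeAct, mul_inv_rev, Units.val_mul, Matrix.mul_assoc]

lemma gEquiv_equivalence (n k : ℕ) : Equivalence (@GEquiv n k) where
  refl x := ⟨1, (gaugeAct_one _).symm⟩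
  symm := by
    rintro x y ⟨g, hg⟩
    exact ⟨g⁻¹, by rw [hg, gaugeAct_gaugeAct, mul_inv_cancel, gaugeAct_one]⟩
  trans := by
    rintro x y z ⟨g, hg⟩ ⟨h, hh⟩
    exact ⟨g * h, by rw [hh, hg, gaugeAct_gaugeAct]⟩

instance gSetoid (n k : ℕ) : Setoid (FreeData n k) := ⟨GEquiv, gEquiv_equivalence n k⟩

/-- The moduli space `𝓜̃` of half-ADHM data. -/
def ModA (n k : ℕ) : Type := Quotient (gSetoid n k)

/-- The class `[(Z, Ψ)]`. -/
def ModA.mk {n k : ℕ} (x : FreeData n k) : ModA n k := Quotient.mk _ x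

/-- `𝓜̃` carries the quotient topology. -/
instance (n k : ℕ) : TopologicalSpace (ModA n k) :=
  inferInstanceAs (TopologicalSpace (Quotient (gSetoid n k)))

/-- The `l_a + 1` rows (numbered from `p = 0`) of the `a`-th blocks of `Ψ_λ` and `Z_λ` stacked
on top of each other: first the unit vectors of the `a`-th block, then `T_{a,1}, …, T_{a,n}`. -/
def stackRow {n k : ℕ} (l : Idx n k) (T : Coord n k) (a : Fin n) (p : ℕ) : Fin k → ℂ :=
  if h : p < l.1 a then Pi.single (l.pos ⟨a, ⟨p, h⟩⟩) 1 else T a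

/-- The pair `(Z_λ, Ψ_λ)` with parameters `T`: the `a`-th row of `Ψ_λ` is the first row of the
`a`-th stack, the `a`-th block of rows of `Z_λ` is the rest of that stack. -/
def patchData {n k : ℕ} (l : Idx n k) (T : Coord n k) : Data n k :=
  (Matrix.of fun i => stackRow l T (l.pos.symm i).1 ((l.pos.symm i).2 + 1),
    Matrix.of fun a => stackRow l T a 0)

lemma patchData_row {n k : ℕ} (l : Idx n k) (T : Coord n k) (a : Fin n) (p : ℕ)
    (hp : p ≤ l.1 a) :
    ((patchData l T).2 * (patchData l T).1 ^ p) a = stackRow l T a p := by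
  induction p with
  | zero => rw [pow_zero, Matrix.mul_one]; rfl
  | succ p ih =>
    have hlt : p < l.1 a := hp
    have h1 := ih hlt.le
    rw [pow_succ, ← Matrix.mul_assoc]
    have h2 : ((patchData l T).2 * (patchData l T).1 ^ p * (patchData l T).1) a =
        Matrix.vecMul (((patchData l T).2 * (patchData l T).1 ^ p) a) (patchData l T).1 := rfl
    rw [h2, h1]
    have h3 : stackRow l T a p = Pi.single (l.pos ⟨a, ⟨p, hlt⟩⟩) 1 := dif_pos hlt
    rw [h3, Matrix.single_one_vecMul]
    change stackRow l T (l.pos.symm (l.pos ⟨a, ⟨p, hlt⟩⟩)).1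
      ((l.pos.symm (l.pos ⟨a, ⟨p, hlt⟩⟩)).2 + 1) = _
    rw [Equiv.symm_apply_apply]

lemma patchData_free {n k : ℕ} (l : Idx n k) (T : Coord n k) (g : GL (Fin k) ℂ)
    (hg : gaugeAct g (patchData l T) = patchData l T) : g = 1 := by
  set Z := (patchData l T).1 with hZ
  set Ψ := (patchData l T).2 with hΨ
  have h1 : (↑g⁻¹ : Matrix (Fin k) (Fin k) ℂ) * Z * (g : Matrix (Fin k) (Fin k) ℂ) = Z :=
    congrArg Prod.fst hg
  have h2 : Ψ * (g : Matrix (Fin k) (Fin k) ℂ) = Ψ := congrArg Prod.snd hg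
  have h3 : Commute Z (g : Matrix (Fin k) (Fin k) ℂ) := by
    have := congrArg (fun A => (g : Matrix (Fin k) (Fin k) ℂ) * A) h1
    simp only [← Matrix.mul_assoc] at this
    rw [← Units.val_mul, mul_inv_cancel, Units.val_one, Matrix.one_mul] at this
    exact this
  have h4 : ∀ p : ℕ, Ψ * Z ^ p * (g : Matrix (Fin k) (Fin k) ℂ) = Ψ * Z ^ p := by
    intro p
    rw [Matrix.mul_assoc, (h3.pow_left p).eq, ← Matrix.mul_assoc, h2]
  apply Units.ext
  rw [Units.val_one]
  apply Matrix.ext_of_single_vecMul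
  intro i
  obtain ⟨⟨a, p⟩, rfl⟩ := l.pos.surjective i
  have h5 : (Ψ * Z ^ (p : ℕ)) a = Pi.single (l.pos ⟨a, p⟩) 1 := by
    rw [hΨ, hZ, patchData_row l T a p p.2.le]
    exact dif_pos p.2
  have h6 : Matrix.vecMul ((Ψ * Z ^ (p : ℕ)) a) (g : Matrix (Fin k) (Fin k) ℂ) =
      (Ψ * Z ^ (p : ℕ)) a := congrFun (h4 p) a
  rw [h5] at h6
  rw [h6, Matrix.vecMul_one]

/-- The inverse of the chart `φ̃_λ` of `𝓜̃`: the class of `(Z_λ, Ψ_λ)` with parameters `T`. -/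
def paramA {n k : ℕ} (l : Idx n k) (T : Coord n k) : ModA n k :=
  ModA.mk ⟨patchData l T, patchData_free l T⟩

/-- The span of the rows `1, …, a` of all the matrices `Ψ Z^p`, `p ≥ 0`. -/
def flagSpan {n k : ℕ} (x : Data n k) (a : ℕ) : Submodule ℂ (Fin k → ℂ) :=
  Submodule.span ℂ {v | ∃ b : Fin n, (b : ℕ) < a ∧ ∃ p : ℕ, v = (x.2 * x.1 ^ p) b}

/-- The triangular stratum of `𝓜̃` with label `λ`: the dimension of the flag jumps by `l_a` in
the `a`-th step. -/
def triA {n k : ℕ} (l : Idx n k) : Set (ModA n k) :=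
  {y | ∃ x : FreeData n k, (∀ a : Fin n, Module.finrank ℂ (flagSpan x.1 (a + 1)) =
    Module.finrank ℂ (flagSpan x.1 a) + l.1 a) ∧ ModA.mk x = y}

/-! ## The half-ADHM relation -/

/-- The relation `D(z) Ψ = J(z) (z 1 - Z)`. -/
def Rel {n k : ℕ} (D : PolyMat n k) (J : Matrix (Fin n) (Fin k) ℂ[X]) (x : FreeData n k) : Prop :=
  D.1 * x.1.2.map C = J * ((X : ℂ[X]) • (1 : Matrix (Fin k) (Fin k) ℂ[X]) - x.1.1.map C)

/-- `D(z)⁻¹ j(z) = O(z⁻¹)` as `z → ∞`, for a column vector `j` of polynomials. -/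
def Decays {n k : ℕ} (D : PolyMat n k) (j : Fin n → ℂ[X]) : Prop :=
  ∀ a, (fun z : ℂ => Matrix.mulVec (D.1.map (eval z))⁻¹ (fun b => (j b).eval z) a)
    =O[Bornology.cobounded ℂ] fun z => z⁻¹

/-- The columns of `J` form a basis of the complex vector space of all polynomial column vectors
`j` with `D⁻¹ j = O(z⁻¹)`. -/
def IsFrame {n k : ℕ} (D : PolyMat n k) (J : Matrix (Fin n) (Fin k) ℂ[X]) : Prop :=
  LinearIndependent ℂ J.col ∧
    ∀ j : Fin n → ℂ[X], Decays D j ↔ j ∈ Submodule.span ℂ (Set.range J.col)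

/-- The matrix `J_λ(z)`: its entry in row `a` and position `p` (from `0`) of the `b`-th block is
the polynomial part of `D_λ(z)_{ab} / z^{p+1}`. -/
def patchJ {n k : ℕ} (l : Idx n k) (T : Coord n k) : Matrix (Fin n) (Fin k) ℂ[X] :=
  Matrix.of fun a i =>
    (if a = (l.pos.symm i).1 then X ^ (l.1 a - 1 - ((l.pos.symm i).2 : ℕ)) else 0) -
      ∑ m : Fin (l.1 (l.pos.symm i).1), if ((l.pos.symm i).2 : ℕ) < m then
        C (T a (l.pos ⟨(l.pos.symm i).1, m⟩)) * X ^ ((m : ℕ) - ((l.pos.symm i).2 : ℕ) - 1) else 0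

/-! ## Atlases -/

/-- The atlas of the charted space consists exactly of charts indexed by `λ`, each defined on the
image of `param λ`, with values filling `ℂ^{nk}`, and inverse to `param λ`. -/
def HasAtlas {n k : ℕ} {M : Type} [TopologicalSpace M] (c : ChartedSpace (Coord n k) M)
    (param : Idx n k → Coord n k → M) : Prop :=
  ∃ φ : Idx n k → OpenPartialHomeomorph M (Coord n k),
    c.atlas = Set.range φ ∧ ∀ l, (φ l).source = Set.range (param l) ∧
      (φ l).target = Set.univ ∧ ∀ T, (φ l).symm T = param l T

end HalfADHM

end

noncomputable section

namespace HalfADHM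

/-! ## Cyclic flags -/

section CyclicFlag

variable {K M ι : Type*} [Field K] [AddCommGroup M] [Module K M]

/-! Both moduli spaces parametrize the `ℂ[X]`-submodules ("lattices") of codimension `k` in the row
vectors `ℂ[X]^n`. A matrix `D` gives its row lattice `latM D`, which determines `D` up to a
unimodular left factor (`vEquiv_iff`). A pair `(Z, Ψ)` gives the kernel `latA` of `f ↦ ∑ f_p Ψ Z^p`.
A free pair is observable, i.e. this map is onto `ℂ^k` (`ev_surjective`), and then the kernel
determines the orbit (`gEquiv_iff`).

The charts describe lattices `L` for which the monomials `z^m e_a`, `m < l_a`, form a basis of the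
quotient; `T` records the reduction of `z^{l_a} e_a` in this basis. Both normal forms with
parameters `T` have the same lattice, so the bijection of lattices is the identity in coordinates. A
greedy choice of basis along the cyclic flag of `e_1, …, e_n` (`exists_cyclic_flag_basis`) shows
that the charts cover, with `T` triangular in either prescribed direction; this also yields the
strata.

The relation `D Ψ = J (z - Z)` forces `latM D ≤ latA (Z, Ψ)`, by substituting `Z` for `z`, and
codimensions give equality. Conversely the normal forms satisfy it by a telescoping sum, and it is
transported by both group actions (`exists_rel_iff`). Since `D⁻¹ J = Ψ (z - Z)⁻¹`, the columns of
`J` decay; observability makes them independent, and decaying columns inject into `ℂ[X]^n / D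
ℂ[X]^n`, of dimension `k`.

Topology is studied on `𝓜̃`, where the quotient map is open and the orbit relation is closed, and
carried to `𝓜` by the bijection. -/

lemma linearIndependent_of_notMem_span_Iio [LinearOrder ι] (v : ι → M)
    (h : ∀ i, v i ∉ Submodule.span K (v '' Iio i)) : LinearIndependent K v := by
  classical
  rw [linearIndependent_iff']
  intro s g hg
  by_contra! hne
  obtain ⟨i₀, hi₀, hgi₀⟩ := hne
  have hnon : (s.filter fun i => g i ≠ 0).Nonempty :=
    ⟨i₀, Finset.mem_filter.2 ⟨hi₀, hgi₀⟩⟩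
  -- In a vanishing combination, the last vector with nonzero coefficient lies in the span of the
  -- earlier ones.
  set i := (s.filter fun i => g i ≠ 0).max' hnon with hi
  obtain ⟨his, hgi⟩ := Finset.mem_filter.1 ((s.filter fun i => g i ≠ 0).max'_mem hnon)
  rw [← hi] at his hgi
  apply h i
  have h1 : g i • v i = - ∑ j ∈ s.erase i, g j • v j := by
    rw [← Finset.add_sum_erase s _ his] at hg
    exact eq_neg_of_add_eq_zero_left hg
  have h2 : g i • v i ∈ Submodule.span K (v '' Iio i) := by
    rw [h1]
    refine Submodule.neg_mem _ (Submodule.sum_mem _ fun j hj => ?_)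
    obtain ⟨hji, hjs⟩ := Finset.mem_erase.1 hj
    by_cases hgj : g j = 0
    · rw [hgj, zero_smul]; exact Submodule.zero_mem _
    · refine Submodule.smul_mem _ _ (Submodule.subset_span ⟨j, ?_, rfl⟩)
      exact lt_of_le_of_ne (Finset.le_max' _ j (Finset.mem_filter.2 ⟨hjs, hgj⟩)) hji
  exact (Submodule.smul_mem_iff _ hgi).1 h2

/-- Given an endomorphism `f` and an ordered family `v` which generates, the cyclic subspaces of
the `v a` are cut down to a basis `f ^ m (v a)`, `m < l a`, compatible with the order. -/
theorem exists_cyclic_flag_basis [Finite ι] [LinearOrder ι] [Module.Finite K M]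
    (f : Module.End K M) (v : ι → M) :
    ∃ l : ι → ℕ, LinearIndependent K (fun i : Σ a, Fin (l a) => (f ^ (i.2 : ℕ)) (v i.1)) ∧
      ∀ a p, (f ^ p) (v a) ∈
        Submodule.span K {x | ∃ b ≤ a, ∃ m : Fin (l b), x = (f ^ (m : ℕ)) (v b)} := by
  classical
  -- `W a` is the part generated before `a`; `N a m` adds the first `m` iterates of `v a`. The
  -- length `l a` is the first `m` at which the next iterate brings nothing new.
  set W : ι → Submodule K M := fun a =>
    Submodule.span K {x | ∃ b < a, ∃ p : ℕ, x = (f ^ p) (v b)} with hW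
  set N : ι → ℕ → Submodule K M := fun a m =>
    W a ⊔ Submodule.span K {x | ∃ j < m, x = (f ^ j) (v a)} with hN
  have hmono : ∀ a m, (fun j => (f ^ j) (v a)) '' Iio m ⊆ N a m := by
    rintro a m _ ⟨j, hj, rfl⟩
    exact Submodule.mem_sup_right (Submodule.subset_span ⟨j, hj, rfl⟩)
  have hex : ∀ a, ∃ m, (f ^ m) (v a) ∈ N a m := by
    intro a
    by_contra! hcon
    have : LinearIndependent K (fun j : ℕ => (f ^ j) (v a)) :=
      linearIndependent_of_notMem_span_Iio _ fun m hm =>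
        hcon m (Submodule.span_le.2 (hmono a m) hm)
    have := this.finite
    exact not_finite ℕ
  set l : ι → ℕ := fun a => Nat.find (hex a) with hl
  have hfind : ∀ a, (f ^ l a) (v a) ∈ N a (l a) := fun a => Nat.find_spec (hex a)
  have hmin : ∀ a m, m < l a → (f ^ m) (v a) ∉ N a m := fun a m => Nat.find_min (hex a)
  refine ⟨l, ?_, ?_⟩
  -- In the lexicographic order, all vectors before `(a, m)` lie in `N a m`, which omits the vector
  -- at `(a, m)` by minimality of `l a`.
  · refine linearIndependent_of_notMem_span_Iio (ι := Σₗ a, Fin (l a))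
      (fun i : Σ a, Fin (l a) => (f ^ (i.2 : ℕ)) (v i.1)) ?_
    rintro ⟨a, m⟩ hm
    refine hmin a m m.2 (Submodule.span_le.2 ?_ hm)
    rintro _ ⟨⟨b, j⟩, hlt, rfl⟩
    rcases Sigma.Lex.lt_def.1 hlt with hba | ⟨hba, hjm⟩
    · exact Submodule.mem_sup_left (Submodule.subset_span ⟨b, hba, j, rfl⟩)
    · change b = a at hba
      subst hba
      exact Submodule.mem_sup_right (Submodule.subset_span ⟨j, hjm, rfl⟩)
  -- Since `W a` is stable under `f`, the dependence at `l a` shifts to every `p ≥ l a`; induction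
  -- on `a` and then on `p` rewrites everything through the short iterates.
  · have hshift : ∀ a m q, (N a m).map (f ^ q) ≤ N a (q + m) := by
      intro a m q
      rw [hN, Submodule.map_sup, Submodule.map_span, Submodule.map_span]
      refine sup_le_sup (Submodule.span_mono ?_) (Submodule.span_mono ?_)
      · rintro _ ⟨_, ⟨b, hb, p, rfl⟩, rfl⟩
        exact ⟨b, hb, q + p, by rw [pow_add]; rfl⟩
      · rintro _ ⟨_, ⟨j, hj, rfl⟩, rfl⟩
        exact ⟨q + j, by omega, by rw [pow_add]; rfl⟩
    intro a
    induction a using WellFoundedLT.induction with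
    | ind a iha =>
    intro p
    induction p using Nat.strong_induction_on with
    | _ p ihp =>
    rcases lt_or_ge p (l a) with hp | hp
    · exact Submodule.subset_span ⟨a, le_rfl, ⟨p, hp⟩, rfl⟩
    · have h1 : (f ^ p) (v a) ∈ N a p := by
        have h2 := hshift a (l a) (p - l a) (Submodule.mem_map_of_mem (hfind a))
        rwa [← Module.End.mul_apply, ← pow_add, Nat.sub_add_cancel hp] at h2
      refine (sup_le ?_ ?_ : N a p ≤ _) h1
      · refine Submodule.span_le.2 ?_
        rintro _ ⟨b, hb, q, rfl⟩
        refine Submodule.span_mono ?_ (iha b hb q)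
        rintro _ ⟨c, hc, m, rfl⟩
        exact ⟨c, hc.trans hb.le, m, rfl⟩
      · refine Submodule.span_le.2 ?_
        rintro _ ⟨j, hj, rfl⟩
        exact ihp j hj

end CyclicFlag

end HalfADHM

end

noncomputable section

namespace HalfADHM

open Matrix Topology Filter

variable {n k : ℕ}

/-! ## Lattices of polynomial row vectors -/

/-- The combination of the monomial vectors `z^m e_a`, `m < l_a`, with given coefficients. -/
def low (l : Idx n k) : (Fin k → ℂ) →ₗ[ℂ] (Fin n → ℂ[X]) :=
  Fintype.linearCombination ℂ fun i => Pi.single (l.pos.symm i).1 (X ^ ((l.pos.symm i).2 : ℕ))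

lemma low_apply (l : Idx n k) (c : Fin k → ℂ) (b : Fin n) :
    low l c b = ∑ m : Fin (l.1 b), C (c (l.pos ⟨b, m⟩)) * X ^ (m : ℕ) := by
  rw [low, Fintype.linearCombination_apply, Finset.sum_apply, ← l.pos.sum_comp,
    Fintype.sum_sigma, Finset.sum_eq_single b]
  · refine Finset.sum_congr rfl fun m _ => ?_
    rw [Equiv.symm_apply_apply, Pi.smul_apply, Pi.single_eq_same, smul_eq_C_mul]
  · intro c _ hc
    refine Finset.sum_eq_zero fun m _ => ?_
    simp [hc.symm]
  · simp

lemma low_single (l : Idx n k) (a : Fin n) (m : Fin (l.1 a)) :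
    low l (Pi.single (l.pos ⟨a, m⟩) 1) = Pi.single a (X ^ (m : ℕ)) := by
  rw [low, Fintype.linearCombination_apply_single, one_smul, Equiv.symm_apply_apply]

/-- Read as a reduction rule: modulo the row lattice, `z^{l_a} e_a` is replaced by the low monomials
with coefficients `T a`. -/
lemma patchMat_row (l : Idx n k) (T : Coord n k) (a : Fin n) :
    patchMat l T a = Pi.single a (X ^ l.1 a) - low l (T a) := by
  ext1 b
  rw [Pi.sub_apply, low_apply, patchMat, Matrix.sub_apply, Matrix.of_apply,
    Matrix.diagonal_apply]
  congr 1
  by_cases h : a = b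
  · subst h; simp
  · rw [if_neg h, Pi.single_eq_of_ne (Ne.symm h)]

/-- The submodule spanned by the rows of a polynomial matrix. -/
def latM (D : Matrix (Fin n) (Fin n) ℂ[X]) : Submodule ℂ[X] (Fin n → ℂ[X]) :=
  LinearMap.range D.vecMulLinear

lemma mem_latM {D : Matrix (Fin n) (Fin n) ℂ[X]} {f : Fin n → ℂ[X]} :
    f ∈ latM D ↔ ∃ g, g ᵥ* D = f := Iff.rfl

lemma row_mem_latM (D : Matrix (Fin n) (Fin n) ℂ[X]) (a : Fin n) : D a ∈ latM D :=
  ⟨Pi.single a 1, by rw [Matrix.vecMulLinear_apply, Matrix.single_one_vecMul]; rfl⟩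

lemma latM_le {D : Matrix (Fin n) (Fin n) ℂ[X]} {L : Submodule ℂ[X] (Fin n → ℂ[X])}
    (h : ∀ a, D a ∈ L) : latM D ≤ L := by
  rintro _ ⟨g, rfl⟩
  rw [Matrix.vecMulLinear_apply, Matrix.vecMul_eq_sum]
  exact Submodule.sum_mem _ fun a _ => L.smul_mem _ (h a)

/-- A `ℂ`-subspace of polynomial vectors which is stable under `z` and contains the unit vectors
is everything. -/
lemma eq_top_of_X_smul_mem (S : Submodule ℂ (Fin n → ℂ[X]))
    (hX : ∀ f ∈ S, (X : ℂ[X]) • f ∈ S) (h1 : ∀ a, Pi.single a 1 ∈ S) (f : Fin n → ℂ[X]) :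
    f ∈ S := by
  have hp : ∀ a (m : ℕ), (Pi.single a (X ^ m) : Fin n → ℂ[X]) ∈ S := by
    intro a m
    induction m with
    | zero => simpa using h1 a
    | succ m ih =>
      have := hX _ ih
      rwa [← Pi.single_smul, smul_eq_mul, ← pow_succ'] at this
  have hq : ∀ a (p : ℂ[X]), (Pi.single a p : Fin n → ℂ[X]) ∈ S := by
    intro a p
    induction p using Polynomial.induction_on' with
    | add p q hp hq => rw [Pi.single_add]; exact S.add_mem hp hq
    | monomial m c =>
      rw [← C_mul_X_pow_eq_monomial, ← smul_eq_C_mul, Pi.single_smul]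
      exact S.smul_mem _ (hp a m)
  rw [← Finset.univ_sum_single f]
  exact S.sum_mem fun a _ => hq a (f a)

/-- Every polynomial row vector can be reduced modulo the rows of `D_λ(T)`. -/
lemma exists_sub_low_mem (l : Idx n k) (T : Coord n k) (f : Fin n → ℂ[X]) :
    ∃ c, f - low l c ∈ latM (patchMat l T) := by
  -- It suffices that lattice plus low vectors is stable under `z` and contains the `e_a`. Exponents
  -- up to and including `l_a` are needed: `z` raises a low monomial to at most `z^{l_a}`, and `e_a`
  -- is itself not low when `l_a = 0`.
  set S : Submodule ℂ (Fin n → ℂ[X]) :=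
    (latM (patchMat l T)).restrictScalars ℂ ⊔ LinearMap.range (low l) with hS
  have hS1 : ∀ g ∈ latM (patchMat l T), g ∈ S := fun g hg => Submodule.mem_sup_left hg
  have hS2 : ∀ c, low l c ∈ S := fun c => Submodule.mem_sup_right ⟨c, rfl⟩
  have hle : ∀ a m, m ≤ l.1 a → (Pi.single a (X ^ m) : Fin n → ℂ[X]) ∈ S := by
    intro a m hm
    rcases hm.lt_or_eq with h | rfl
    · rw [← low_single l a ⟨m, h⟩]; exact hS2 _
    · have h1 := hS1 _ (row_mem_latM (patchMat l T) a)
      rw [patchMat_row] at h1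
      have := S.add_mem h1 (hS2 (T a))
      rwa [sub_add_cancel] at this
  have hlow : ∀ c, (X : ℂ[X]) • low l c ∈ S := by
    intro c
    rw [low, Fintype.linearCombination_apply, Finset.smul_sum]
    refine S.sum_mem fun i _ => ?_
    rw [smul_comm, ← Pi.single_smul, smul_eq_mul, ← pow_succ']
    exact S.smul_mem _ (hle _ _ (l.pos.symm i).2.2)
  have hf : f ∈ S := by
    refine eq_top_of_X_smul_mem S ?_ ?_ f
    · intro g hg
      obtain ⟨u, hu, w, ⟨c, rfl⟩, rfl⟩ := Submodule.mem_sup.1 hg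
      rw [smul_add]
      exact S.add_mem (hS1 _ (Submodule.smul_mem _ _ hu)) (hlow c)
    · intro a
      simpa using hle a 0 (Nat.zero_le _)
  obtain ⟨u, hu, w, ⟨c, rfl⟩, rfl⟩ := Submodule.mem_sup.1 hf
  exact ⟨c, by simpa using hu⟩

/-- A lattice which contains the rows of `D_λ(T)`, and in whose quotient the monomials `z^m e_a`,
`m < l_a`, are independent, is spanned by the rows of `D_λ(T)`. -/
lemma eq_latM_patchMat (l : Idx n k) (T : Coord n k) (L : Submodule ℂ[X] (Fin n → ℂ[X]))
    (hrow : ∀ a, Pi.single a (X ^ l.1 a) - low l (T a) ∈ L)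
    (hlow : ∀ c, low l c ∈ L → c = 0) : L = latM (patchMat l T) := by
  have hle : latM (patchMat l T) ≤ L := latM_le fun a => by rw [patchMat_row]; exact hrow a
  refine le_antisymm (fun f hf => ?_) hle
  obtain ⟨c, hc⟩ := exists_sub_low_mem l T f
  have h2 : low l c ∈ L := by
    have := L.sub_mem hf (hle hc)
    rwa [sub_sub_cancel] at this
  rw [hlow c h2] at hc
  simpa using hc

/-! ## The lattice of a pair of matrices -/

/-- The row vector `∑_p f_p Ψ Z^p` for `f = ∑_p f_p z^p`. -/
def ev (x : Data n k) : (Fin n → ℂ[X]) →ₗ[ℂ] (Fin k → ℂ) where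
  toFun f := ∑ a, x.2 a ᵥ* aeval x.1 (f a)
  map_add' f g := by simp [Matrix.vecMul_add, Finset.sum_add_distrib]
  map_smul' c f := by simp [Matrix.vecMul_smul, Finset.smul_sum]

lemma ev_apply (x : Data n k) (f : Fin n → ℂ[X]) :
    ev x f = ∑ a, x.2 a ᵥ* aeval x.1 (f a) := rfl

/-- Powers of `Z` commute, so `ev` intertwines multiplication by a polynomial with its value at `Z`;
this makes the kernel a `ℂ[X]`-submodule. -/
lemma ev_smul (x : Data n k) (p : ℂ[X]) (f : Fin n → ℂ[X]) :
    ev x (p • f) = ev x f ᵥ* aeval x.1 p := by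
  rw [ev_apply, ev_apply, Matrix.sum_vecMul]
  refine Finset.sum_congr rfl fun a _ => ?_
  rw [Matrix.vecMul_vecMul, Pi.smul_apply, smul_eq_mul, mul_comm, map_mul]

lemma ev_single (x : Data n k) (a : Fin n) (m : ℕ) :
    ev x (Pi.single a (X ^ m)) = (x.2 * x.1 ^ m) a := by
  rw [ev_apply, Finset.sum_eq_single a]
  · rw [Pi.single_eq_same, map_pow, aeval_X]; rfl
  · intro b _ hb
    rw [Pi.single_eq_of_ne hb, map_zero, Matrix.vecMul_zero]
  · simp

/-- The lattice of polynomial row vectors `f` with `∑_p f_p Ψ Z^p = 0`. -/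
def latA (x : Data n k) : Submodule ℂ[X] (Fin n → ℂ[X]) where
  carrier := {f | ev x f = 0}
  add_mem' {f g} hf hg := by
    rw [Set.mem_ofPred_eq] at *; rw [map_add, hf, hg, add_zero]
  zero_mem' := map_zero _
  smul_mem' p f hf := by
    rw [Set.mem_ofPred_eq] at *; rw [ev_smul, hf, Matrix.zero_vecMul]

lemma mem_latA {x : Data n k} {f : Fin n → ℂ[X]} : f ∈ latA x ↔ ev x f = 0 := Iff.rfl

/-- The square matrix with rows `(Ψ Z^m)_a`, `m < l_a`. -/
def frameMat (l : Idx n k) (x : Data n k) : Matrix (Fin k) (Fin k) ℂ :=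
  Matrix.of fun i => (x.2 * x.1 ^ ((l.pos.symm i).2 : ℕ)) (l.pos.symm i).1

lemma frameMat_row (l : Idx n k) (x : Data n k) (a : Fin n) (m : Fin (l.1 a)) :
    frameMat l x (l.pos ⟨a, m⟩) = (x.2 * x.1 ^ (m : ℕ)) a := by
  change (x.2 * x.1 ^ ((l.pos.symm (l.pos ⟨a, m⟩)).2 : ℕ)) (l.pos.symm (l.pos ⟨a, m⟩)).1 = _
  rw [Equiv.symm_apply_apply]

lemma ev_low (l : Idx n k) (x : Data n k) (c : Fin k → ℂ) :
    ev x (low l c) = c ᵥ* frameMat l x := by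
  rw [low, Fintype.linearCombination_apply, map_sum, Matrix.vecMul_eq_sum]
  refine Finset.sum_congr rfl fun i _ => ?_
  rw [map_smul, ev_single]; rfl

/-- The coordinates of a pair of matrices in the chart with label `l`. -/
def coordOf (l : Idx n k) (x : Data n k) : Coord n k := fun a =>
  -- The inverse is written through the adjugate so that continuity and holomorphy where the
  -- determinant is nonzero reduce to polynomial expressions.
  (frameMat l x).det⁻¹ • ((x.2 * x.1 ^ l.1 a) a ᵥ* (frameMat l x).adjugate)

lemma coordOf_eq (l : Idx n k) (x : Data n k) (a : Fin n) :
    coordOf l x a = (x.2 * x.1 ^ l.1 a) a ᵥ* (frameMat l x)⁻¹ := by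
  rw [coordOf, Matrix.inv_def, Matrix.vecMul_smul, Ring.inverse_eq_inv]

lemma coordOf_vecMul {l : Idx n k} {x : Data n k} (h : (frameMat l x).det ≠ 0) (a : Fin n) :
    coordOf l x a ᵥ* frameMat l x = (x.2 * x.1 ^ l.1 a) a := by
  rw [coordOf_eq, Matrix.vecMul_vecMul, Matrix.nonsing_inv_mul _ (isUnit_iff_ne_zero.2 h),
    Matrix.vecMul_one]

lemma low_mem_latA_imp {l : Idx n k} {x : Data n k} (h : (frameMat l x).det ≠ 0)
    (c : Fin k → ℂ) (hc : low l c ∈ latA x) : c = 0 := by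
  rw [mem_latA, ev_low] at hc
  exact Matrix.eq_zero_of_vecMul_eq_zero h hc

lemma low_coordOf_mem_latA {l : Idx n k} {x : Data n k} (h : (frameMat l x).det ≠ 0)
    (a : Fin n) : Pi.single a (X ^ l.1 a) - low l (coordOf l x a) ∈ latA x := by
  rw [mem_latA, map_sub, ev_low, ev_single, coordOf_vecMul h, sub_self]

/-- Invertibility of the frame says that the low monomials are independent modulo `latA x`, and
`coordOf` expands the image of `z^{l_a} e_a` in that frame. -/
lemma latA_eq_latM {l : Idx n k} {x : Data n k} (h : (frameMat l x).det ≠ 0) :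
    latA x = latM (patchMat l (coordOf l x)) :=
  eq_latM_patchMat l _ _ (low_coordOf_mem_latA h) (low_mem_latA_imp h)

/-- The normal form is the representative of the orbit whose frame is the standard basis. -/
lemma frameMat_patchData (l : Idx n k) (T : Coord n k) : frameMat l (patchData l T) = 1 := by
  refine funext fun i => ?_
  obtain ⟨⟨a, m⟩, rfl⟩ := l.pos.surjective i
  rw [frameMat_row, patchData_row l T a m m.2.le, stackRow, dif_pos m.2]
  ext j
  rw [Matrix.one_apply, Pi.single_apply]
  simp [eq_comm]

lemma frameMat_patchData_det (l : Idx n k) (T : Coord n k) :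
    (frameMat l (patchData l T)).det ≠ 0 := by
  rw [frameMat_patchData, Matrix.det_one]; exact one_ne_zero

lemma coordOf_patchData (l : Idx n k) (T : Coord n k) : coordOf l (patchData l T) = T := by
  ext1 a
  rw [coordOf_eq, frameMat_patchData, inv_one, Matrix.vecMul_one,
    patchData_row l T a _ le_rfl, stackRow, dif_neg (lt_irrefl _)]

lemma latA_patchData (l : Idx n k) (T : Coord n k) :
    latA (patchData l T) = latM (patchMat l T) := by
  rw [latA_eq_latM (frameMat_patchData_det l T), coordOf_patchData]

/-! ## Gauge transformations -/

lemma gaugeAct_mul_pow (g : GL (Fin k) ℂ) (x : Data n k) (p : ℕ) :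
    (gaugeAct g x).2 * (gaugeAct g x).1 ^ p = x.2 * x.1 ^ p * (g : Matrix (Fin k) (Fin k) ℂ) := by
  induction p with
  | zero => simp [gaugeAct]
  | succ p ih =>
    rw [pow_succ, ← Matrix.mul_assoc, ih]
    simp only [gaugeAct, Matrix.mul_assoc, pow_succ]
    congr 2
    rw [← Matrix.mul_assoc, ← Units.val_mul, mul_inv_cancel, Units.val_one, Matrix.one_mul]

/-- The `f` satisfying the identity form a subspace containing the unit vectors and stable under
`z`, because `g` intertwines the two matrices. -/
lemma ev_gaugeAct (g : GL (Fin k) ℂ) (x : Data n k) (f : Fin n → ℂ[X]) :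
    ev (gaugeAct g x) f = ev x f ᵥ* (g : Matrix (Fin k) (Fin k) ℂ) := by
  set S := LinearMap.eqLocus (ev (gaugeAct g x)) ((Matrix.vecMulLinear
    (g : Matrix (Fin k) (Fin k) ℂ)).comp (ev x))
  have hS : ∀ f, f ∈ S ↔ ev (gaugeAct g x) f = ev x f ᵥ* (g : Matrix (Fin k) (Fin k) ℂ) :=
    fun _ => Iff.rfl
  refine (hS f).1 (eq_top_of_X_smul_mem S ?_ ?_ f)
  · intro f hf
    rw [hS] at *
    rw [ev_smul, ev_smul, hf]
    simp only [aeval_X, gaugeAct, Matrix.vecMul_vecMul, ← Matrix.mul_assoc]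
    rw [← Units.val_mul, mul_inv_cancel, Units.val_one, Matrix.one_mul]
  · intro a
    rw [hS, ← pow_zero X, ev_single, ev_single, gaugeAct_mul_pow]; rfl

lemma latA_gaugeAct (g : GL (Fin k) ℂ) (x : Data n k) : latA (gaugeAct g x) = latA x := by
  ext f
  rw [mem_latA, mem_latA, ev_gaugeAct]
  refine ⟨fun h => ?_, fun h => by rw [h, Matrix.zero_vecMul]⟩
  have := congrArg (fun v => v ᵥ* (↑g⁻¹ : Matrix (Fin k) (Fin k) ℂ)) h
  simpa only [Matrix.vecMul_vecMul, Units.mul_inv, Matrix.vecMul_one, Matrix.zero_vecMul] using this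

lemma frameMat_gaugeAct (l : Idx n k) (g : GL (Fin k) ℂ) (x : Data n k) :
    frameMat l (gaugeAct g x) = frameMat l x * (g : Matrix (Fin k) (Fin k) ℂ) := by
  refine funext fun i => ?_
  change ((gaugeAct g x).2 * (gaugeAct g x).1 ^ ((l.pos.symm i).2 : ℕ)) (l.pos.symm i).1 = _
  rw [gaugeAct_mul_pow]; rfl

/-- A pair in the domain of a chart is equivalent to the normal form. -/
lemma exists_gaugeAct_eq_patchData {l : Idx n k} {x : Data n k} (h : (frameMat l x).det ≠ 0) :
    ∃ g : GL (Fin k) ℂ, gaugeAct g x = patchData l (coordOf l x) := by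
  set B := frameMat l x with hB
  have hu : IsUnit B.det := isUnit_iff_ne_zero.2 h
  set g : GL (Fin k) ℂ := ⟨B⁻¹, B, Matrix.nonsing_inv_mul _ hu, Matrix.mul_nonsing_inv _ hu⟩
  have hrow : ∀ a p, p ≤ l.1 a →
      (x.2 * x.1 ^ p) a ᵥ* B⁻¹ = stackRow l (coordOf l x) a p := by
    intro a p hp
    rcases hp.lt_or_eq with hlt | rfl
    · rw [stackRow, dif_pos hlt, ← frameMat_row l x a ⟨p, hlt⟩, ← hB]
      have : B (l.pos ⟨a, ⟨p, hlt⟩⟩) = Pi.single (l.pos ⟨a, ⟨p, hlt⟩⟩) 1 ᵥ* B := by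
        rw [Matrix.single_one_vecMul]; rfl
      rw [this, Matrix.vecMul_vecMul, Matrix.mul_nonsing_inv _ hu, Matrix.vecMul_one]
    · rw [stackRow, dif_neg (lt_irrefl _), coordOf_eq]
  refine ⟨g, Prod.ext ?_ ?_⟩
  · refine funext fun i => ?_
    change (B * x.1 * B⁻¹) i = stackRow l _ _ _
    -- Multiplying the frame row `(a, p)` by `Z` gives row `p + 1` of the stack; since `p + 1 ≤
    -- l_a`, this includes the last row `T_a`.
    rw [← hrow _ _ (l.pos.symm i).2.2, pow_succ, ← Matrix.mul_assoc]
    rfl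
  · refine funext fun a => ?_
    change (x.2 * B⁻¹) a = stackRow l _ _ _
    rw [← hrow _ _ (Nat.zero_le _), pow_zero, Matrix.mul_one]
    rfl

/-! ## Lattices of finite codimension -/

/-- The quotient of the space of polynomial row vectors by a lattice, over `ℂ`. -/
abbrev LatQuot (L : Submodule ℂ[X] (Fin n → ℂ[X])) : Type :=
  (Fin n → ℂ[X]) ⧸ L.restrictScalars ℂ

lemma latQuot_mk_eq_zero {L : Submodule ℂ[X] (Fin n → ℂ[X])} {f : Fin n → ℂ[X]} :
    (Submodule.mkQ (L.restrictScalars ℂ) f) = 0 ↔ f ∈ L := by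
  rw [Submodule.mkQ_apply, Submodule.Quotient.mk_eq_zero, Submodule.restrictScalars_mem]

/-- Both orders are needed: `b ≤ a` makes `T^{ab}` vanish for `a < b`, as in the strata of `𝓜̃`, and
the reverse order gives the strata of `𝓜`. -/
lemma exists_cyclic_flag_basis_of_order {K M : Type*} [Field K] [AddCommGroup M] [Module K M]
    [Module.Finite K M] (r : Fin n → Fin n → Prop)
    (hr : r = (fun a b => a ≤ b) ∨ r = (fun a b => b ≤ a)) (f : Module.End K M) (v : Fin n → M) :
    ∃ l : Fin n → ℕ, LinearIndependent K (fun i : Σ a, Fin (l a) => (f ^ (i.2 : ℕ)) (v i.1)) ∧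
      ∀ a p, (f ^ p) (v a) ∈
        Submodule.span K {x | ∃ b, r b a ∧ ∃ m : Fin (l b), x = (f ^ (m : ℕ)) (v b)} := by
  rcases hr with rfl | rfl
  · exact exists_cyclic_flag_basis f v
  · exact exists_cyclic_flag_basis (ι := (Fin n)ᵒᵈ) f v

/-- Every lattice of finite codimension is spanned by the rows of a triangular normal form. -/
theorem exists_eq_latM_patchMat (L : Submodule ℂ[X] (Fin n → ℂ[X])) [Module.Finite ℂ (LatQuot L)]
    (r : Fin n → Fin n → Prop) (hr : r = (fun a b => a ≤ b) ∨ r = (fun a b => b ≤ a)) :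
    ∃ (k : ℕ) (l : Idx n k) (T : Coord n k), L = latM (patchMat l T) ∧
      ∀ a b, ¬ r b a → ∀ m, T a (l.pos ⟨b, m⟩) = 0 := by
  classical
  set π := Submodule.mkQ (L.restrictScalars ℂ) with hπ
  set f : Module.End ℂ (LatQuot L) := Submodule.mapQ _ _
    (LinearMap.lsmul ℂ[X] (Fin n → ℂ[X]) X |>.restrictScalars ℂ)
    (fun g hg => L.smul_mem X hg) with hf
  have hfπ : ∀ g, f (π g) = π ((X : ℂ[X]) • g) := fun g => rfl
  have hpow : ∀ (p : ℕ) (a : Fin n), (f ^ p) (π (Pi.single a 1)) = π (Pi.single a (X ^ p)) := by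
    intro p a
    induction p with
    | zero => simp
    | succ p ih =>
      rw [pow_succ', Module.End.mul_apply, ih, hfπ, ← Pi.single_smul, smul_eq_mul, ← pow_succ']
  obtain ⟨l₀, hli, hspan⟩ := exists_cyclic_flag_basis_of_order r hr f
    (fun a => π (Pi.single a 1))
  set l : Idx n (∑ a, l₀ a) := ⟨l₀, rfl⟩
  have hlow : ∀ c, π (low l c) = ∑ i : (Σ a, Fin (l₀ a)), c (l.pos i) •
      (f ^ (i.2 : ℕ)) (π (Pi.single i.1 1)) := by
    intro c
    rw [low, Fintype.linearCombination_apply, map_sum, ← l.pos.sum_comp]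
    refine Finset.sum_congr rfl fun i _ => ?_
    rw [map_smul, hpow, Equiv.symm_apply_apply]
  have hT : ∀ a, ∃ c : Fin (∑ a, l₀ a) → ℂ, π (low l c) = π (Pi.single a (X ^ l₀ a)) ∧
      ∀ b, ¬ r b a → ∀ m, c (l.pos ⟨b, m⟩) = 0 := by
    intro a
    have h1 := hspan a (l₀ a)
    rw [hpow] at h1
    -- Coefficient vectors supported in the blocks `b` with `r b a`; their images contain the flag
    -- span, so the reduction of `z^{l_a} e_a` can be chosen triangular.
    set S : Submodule ℂ (Fin (∑ a, l₀ a) → ℂ) :=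
      ⨅ (b : Fin n) (_ : ¬ r b a) (m : Fin (l₀ b)), LinearMap.ker
        (LinearMap.proj (R := ℂ) (φ := fun _ => ℂ) (l.pos ⟨b, m⟩)) with hS
    have hS' : ∀ c, c ∈ S ↔ ∀ b, ¬ r b a → ∀ m, c (l.pos ⟨b, m⟩) = 0 := by
      intro c; simp only [hS, Submodule.mem_iInf, LinearMap.mem_ker, LinearMap.proj_apply]
      rfl
    have h2 : Submodule.span ℂ {x | ∃ b, r b a ∧ ∃ m : Fin (l₀ b),
        x = (f ^ (m : ℕ)) (π (Pi.single b 1))} ≤ S.map (π.comp (low l)) := by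
      refine Submodule.span_le.2 ?_
      rintro _ ⟨b, hb, m, rfl⟩
      refine ⟨Pi.single (l.pos ⟨b, m⟩) 1, ?_, ?_⟩
      · refine (hS' _).2 fun b' hb' m' => Pi.single_eq_of_ne (fun h => hb' ?_) _
        have := congrArg Sigma.fst (l.pos.injective h)
        rw [show b' = b from this]; exact hb
      · rw [LinearMap.comp_apply, low_single, hpow]
    obtain ⟨c, hc, hc'⟩ := h2 h1
    exact ⟨c, hc', (hS' c).1 hc⟩
  choose T hT hT0 using hT
  refine ⟨_, l, T, eq_latM_patchMat l T L (fun a => ?_) (fun c hc => ?_), hT0⟩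
  · rw [← latQuot_mk_eq_zero, map_sub, sub_eq_zero]
    exact (hT a).symm
  · rw [← latQuot_mk_eq_zero, ← hπ, hlow] at hc
    have h := Fintype.linearIndependent_iff.1 hli (fun i => c (l.pos i)) hc
    ext i
    obtain ⟨j, rfl⟩ := l.pos.surjective i
    exact h j

/-- By Cramer's rule `det D · f` lies in the row lattice, so each entry can be reduced modulo `det
D`. -/
lemma finite_latQuot_of_det_ne_zero (D : Matrix (Fin n) (Fin n) ℂ[X]) (hD : D.det ≠ 0) :
    Module.Finite ℂ (LatQuot (latM D)) := by
  set d := D.det.natDegree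
  have : Module.Finite ℂ (degreeLT ℂ d) := Module.Finite.equiv (degreeLTEquiv ℂ d).symm
  refine Module.Finite.of_surjective ((Submodule.mkQ ((latM D).restrictScalars ℂ)).comp
    ((degreeLT ℂ d).subtype.compLeft (Fin n))) fun q => ?_
  obtain ⟨f, rfl⟩ := Submodule.mkQ_surjective _ q
  refine ⟨fun a => ⟨f a % D.det, ?_⟩, ?_⟩
  · rw [mem_degreeLT, ← degree_eq_natDegree hD]
    exact degree_mod_lt _ hD
  · rw [LinearMap.comp_apply, ← sub_eq_zero, ← map_sub, latQuot_mk_eq_zero]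
    refine ⟨(-fun a => f a / D.det) ᵥ* D.adjugate, ?_⟩
    rw [Matrix.vecMulLinear_apply, Matrix.vecMul_vecMul, Matrix.adjugate_mul, Matrix.vecMul_smul,
      Matrix.vecMul_one]
    ext1 a
    change D.det * -(f a / D.det) = f a % D.det - f a
    linear_combination -EuclideanDomain.div_add_mod (f a) D.det

/-- The codimension of the lattice of an observable pair. -/
lemma finrank_latQuot_latA {x : Data n k} (hx : Function.Surjective (ev x)) :
    Module.Finite ℂ (LatQuot (latA x)) ∧ Module.finrank ℂ (LatQuot (latA x)) = k := by
  have hker : (latA x).restrictScalars ℂ = LinearMap.ker (ev x) := rfl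
  have e : LatQuot (latA x) ≃ₗ[ℂ] (Fin k → ℂ) :=
    (ev x).quotKerEquivOfSurjective hx
  exact ⟨Module.Finite.equiv e.symm, by rw [e.finrank_eq, Module.finrank_fin_fun]⟩

lemma ev_patchData_surjective (l : Idx n k) (T : Coord n k) :
    Function.Surjective (ev (patchData l T)) := fun c =>
  ⟨low l c, by rw [ev_low, frameMat_patchData, Matrix.vecMul_one]⟩

lemma finrank_latQuot_patchMat (l : Idx n k) (T : Coord n k) :
    Module.finrank ℂ (LatQuot (latM (patchMat l T))) = k := by
  rw [← latA_patchData]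
  exact (finrank_latQuot_latA (ev_patchData_surjective l T)).2

lemma low_mem_patchMat_imp {l : Idx n k} {T : Coord n k} {c : Fin k → ℂ}
    (hc : low l c ∈ latM (patchMat l T)) : c = 0 := by
  rw [← latA_patchData] at hc
  exact low_mem_latA_imp (frameMat_patchData_det l T) c hc

/-! ### Lattices as invariants and their normal forms -/

/-- Matrices with the same row lattice differ by a unimodular factor. -/
lemma exists_isUnit_det_of_latM_eq {D D' : Matrix (Fin n) (Fin n) ℂ[X]} (hD : D.det ≠ 0)
    (h : latM D = latM D') : ∃ V : Matrix (Fin n) (Fin n) ℂ[X], IsUnit V.det ∧ D' = V * D := by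
  have key : ∀ {A B : Matrix (Fin n) (Fin n) ℂ[X]}, latM A = latM B →
      ∃ V : Matrix (Fin n) (Fin n) ℂ[X], B = V * A := by
    intro A B hAB
    have : ∀ a, ∃ g, g ᵥ* A = B a := fun a => mem_latM.1 (hAB ▸ row_mem_latM B a)
    choose V hV using this
    exact ⟨Matrix.of V, funext fun a => (hV a).symm⟩
  obtain ⟨V, hV⟩ := key h
  obtain ⟨W, hW⟩ := key h.symm
  -- From `D = W V D`, cancelling the nonzero determinant of `D` gives `det W · det V = 1`.
  refine ⟨V, IsUnit.of_mul_eq_one_right W.det (mul_right_cancel₀ hD ?_), hV⟩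
  rw [one_mul, ← Matrix.det_mul, ← Matrix.det_mul, Matrix.mul_assoc, ← hV, ← hW]

lemma PolyMat.det_ne_zero (D : PolyMat n k) : D.1.det ≠ 0 := by
  intro h
  have := D.2
  rw [h, degree_zero] at this
  exact WithBot.bot_ne_coe this

lemma vEquiv_iff {D D' : PolyMat n k} : VEquiv D D' ↔ latM D.1 = latM D'.1 := by
  constructor
  · have hle : ∀ {D D' : PolyMat n k}, VEquiv D D' → latM D'.1 ≤ latM D.1 := by
      rintro D D' ⟨V, hV⟩
      exact latM_le fun a => ⟨V.1 a, by rw [hV]; rfl⟩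
    exact fun h => le_antisymm (hle ((vEquiv_equivalence n k).symm h)) (hle h)
  · intro h
    obtain ⟨V, hV, hVD⟩ := exists_isUnit_det_of_latM_eq D.det_ne_zero h
    exact ⟨⟨V, by simpa using Polynomial.isUnit_iff_degree_eq_zero.1 hV⟩, hVD⟩

/-- The normal form of a polynomial matrix. -/
theorem exists_latM_eq_patchMat (D : PolyMat n k) (r : Fin n → Fin n → Prop)
    (hr : r = (fun a b => a ≤ b) ∨ r = (fun a b => b ≤ a)) :
    ∃ (l : Idx n k) (T : Coord n k), latM D.1 = latM (patchMat l T) ∧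
      ∀ a b, ¬ r b a → ∀ m, T a (l.pos ⟨b, m⟩) = 0 := by
  have := finite_latQuot_of_det_ne_zero D.1 D.det_ne_zero
  obtain ⟨k', l, T, hL, hT⟩ := exists_eq_latM_patchMat (latM D.1) r hr
  obtain ⟨V, hV, hVD⟩ := exists_isUnit_det_of_latM_eq D.det_ne_zero hL
  -- The size found by the greedy basis is the degree of the determinant, which a unimodular factor
  -- does not change.
  have hk : k' = k := by
    have h1 := patchMat_det_degree l T
    rw [hVD, Matrix.det_mul, degree_mul, Polynomial.isUnit_iff_degree_eq_zero.1 hV, D.2,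
      zero_add] at h1
    exact_mod_cast h1.symm
  subst hk
  exact ⟨l, T, hL, hT⟩

/-- The normal form of an observable pair. -/
theorem exists_latA_eq_patchMat {x : Data n k} (hx : Function.Surjective (ev x))
    (r : Fin n → Fin n → Prop) (hr : r = (fun a b => a ≤ b) ∨ r = (fun a b => b ≤ a)) :
    ∃ (l : Idx n k) (T : Coord n k), latA x = latM (patchMat l T) ∧
      ∀ a b, ¬ r b a → ∀ m, T a (l.pos ⟨b, m⟩) = 0 := by
  obtain ⟨hfin, hrank⟩ := finrank_latQuot_latA hx
  obtain ⟨k', l, T, hL, hT⟩ := exists_eq_latM_patchMat (latA x) r hr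
  have hk : k' = k := by
    rw [← finrank_latQuot_patchMat l T, ← hL, hrank]
  subst hk
  exact ⟨l, T, hL, hT⟩

/-- A relation among the frame rows would be a nonzero low vector in the lattice, but the lattice of
a normal form contains none. -/
lemma frameMat_det_ne_zero {x : Data n k} {l : Idx n k} {T : Coord n k}
    (h : latA x = latM (patchMat l T)) : (frameMat l x).det ≠ 0 := by
  intro hdet
  obtain ⟨c, hc, hc0⟩ := Matrix.exists_vecMul_eq_zero_iff.2 hdet
  refine hc (low_mem_patchMat_imp (l := l) (T := T) ?_)
  rw [← h, mem_latA, ev_low, hc0]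

/-- The difference of corresponding rows is a low vector in the common lattice, hence zero. This
gives injectivity of the charts. -/
lemma eq_of_latM_patchMat_eq {l : Idx n k} {T T' : Coord n k}
    (h : latM (patchMat l T) = latM (patchMat l T')) : T = T' := by
  ext1 a
  have h1 := row_mem_latM (patchMat l T) a
  have h2 := row_mem_latM (patchMat l T') a
  rw [← h, patchMat_row] at h2
  rw [patchMat_row] at h1
  have h3 := Submodule.sub_mem _ h2 h1
  rw [sub_sub_sub_cancel_left, ← map_sub] at h3
  exact sub_eq_zero.1 (low_mem_patchMat_imp h3)

lemma coordOf_eq_of_latA_eq {x : Data n k} {l : Idx n k} {T : Coord n k}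
    (h : latA x = latM (patchMat l T)) : coordOf l x = T :=
  eq_of_latM_patchMat_eq (l := l) (by rw [← h, latA_eq_latM (frameMat_det_ne_zero h)])

lemma exists_gaugeAct_of_latA_eq {x : Data n k} {l : Idx n k} {T : Coord n k}
    (h : latA x = latM (patchMat l T)) : ∃ g : GL (Fin k) ℂ, gaugeAct g x = patchData l T := by
  have := exists_gaugeAct_eq_patchData (frameMat_det_ne_zero h)
  rwa [coordOf_eq_of_latA_eq h] at this

/-! ## Free pairs are observable -/

lemma exists_det_one_add_smul_ne_zero (A : Matrix (Fin k) (Fin k) ℂ) :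
    ∃ t : ℂ, t ≠ 0 ∧ (1 + t • A).det ≠ 0 := by
  have hc : Continuous fun t : ℂ => (1 + t • A).det := by fun_prop
  have h0 : ∀ᶠ t in nhds (0 : ℂ), (1 + t • A).det ≠ 0 :=
    hc.continuousAt.eventually_ne (by simp)
  obtain ⟨t, ht, ht0⟩ :=
    ((h0.filter_mono nhdsWithin_le_nhds).and (self_mem_nhdsWithin (s := {(0 : ℂ)}ᶜ))).exists
  exact ⟨t, ht0, ht⟩

/-- If `ev` is not onto, the unobservable space `N = {c | Ψ Z^p c = 0 for all p}` is nonzero and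
`Z`-stable. With an eigenvector `v ∈ N` and a left eigenvector `w` for the same eigenvalue, `1 + t v
wᵀ` commutes with `Z` and fixes `Ψ`, contradicting freeness. -/
lemma ev_surjective (x : FreeData n k) : Function.Surjective (ev x.1) := by
  obtain ⟨⟨Z, Ψ⟩, hfree⟩ := x
  rw [← LinearMap.range_eq_top]
  by_contra hne
  obtain ⟨φ, hφ0, hφ⟩ := Submodule.exists_le_ker_of_lt_top _ (lt_top_iff_ne_top.2 hne)
  set N : Submodule ℂ (Fin k → ℂ) := ⨅ p : ℕ, LinearMap.ker (Ψ * Z ^ p).mulVecLin with hN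
  have hN' : ∀ c, c ∈ N ↔ ∀ p, (Ψ * Z ^ p) *ᵥ c = 0 := by
    intro c; simp [hN, Submodule.mem_iInf]
  have hφv : ∀ v, φ v = ∑ i, v i * φ (Pi.single i 1) := by
    intro v
    conv_lhs => rw [← Finset.univ_sum_single v, map_sum]
    refine Finset.sum_congr rfl fun i _ => ?_
    rw [← smul_eq_mul, ← map_smul, ← Pi.single_smul, smul_eq_mul, mul_one]
  -- A functional vanishing on the range of `ev`, written as a column, is killed by every `Ψ Z^p`.
  have hc : (fun i => φ (Pi.single i 1)) ∈ N := by
    refine (hN' _).2 fun p => funext fun a => ?_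
    have h1 : φ (ev (Z, Ψ) (Pi.single a (X ^ p))) = 0 := hφ ⟨_, rfl⟩
    rw [ev_single, hφv] at h1
    exact h1
  have hNZ : ∀ c ∈ N, Z.mulVecLin c ∈ N := by
    intro c hc
    refine (hN' _).2 fun p => ?_
    rw [Matrix.mulVecLin_apply, Matrix.mulVec_mulVec, Matrix.mul_assoc, ← pow_succ]
    exact (hN' c).1 hc (p + 1)
  have : Nontrivial N := by
    refine ⟨⟨⟨_, hc⟩, 0, fun h => hφ0 ?_⟩⟩
    have h' := congrArg Subtype.val h
    refine LinearMap.pi_ext' fun i => LinearMap.ext_ring ?_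
    simpa using congrFun h' i
  obtain ⟨μ, hμ⟩ := Module.End.exists_eigenvalue (Z.mulVecLin.restrict hNZ)
  obtain ⟨⟨v, hvN⟩, hv⟩ := hμ.exists_hasEigenvector
  have hv0 : v ≠ 0 := fun h => hv.2 (Subtype.ext h)
  have hZv : Z *ᵥ v = μ • v := congrArg Subtype.val hv.apply_eq_smul
  have hdet : (Z - μ • (1 : Matrix (Fin k) (Fin k) ℂ)).det = 0 := by
    refine Matrix.exists_mulVec_eq_zero_iff.1 ⟨v, hv0, ?_⟩
    rw [Matrix.sub_mulVec, hZv, Matrix.smul_mulVec, Matrix.one_mulVec, sub_self]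
  obtain ⟨w, hw0, hw⟩ := Matrix.exists_vecMul_eq_zero_iff.2 hdet
  have hwZ : w ᵥ* Z = μ • w := by
    rwa [Matrix.vecMul_sub, Matrix.vecMul_smul, Matrix.vecMul_one, sub_eq_zero] at hw
  obtain ⟨t, ht, hdet⟩ := exists_det_one_add_smul_ne_zero (Matrix.vecMulVec v w)
  set g := Matrix.GeneralLinearGroup.mkOfDetNeZero _ hdet with hg
  have hgv : (g : Matrix (Fin k) (Fin k) ℂ) = 1 + t • Matrix.vecMulVec v w := rfl
  have hcomm : Z * (g : Matrix (Fin k) (Fin k) ℂ) = (g : Matrix (Fin k) (Fin k) ℂ) * Z := by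
    rw [hgv, mul_add, add_mul, mul_one, one_mul, Matrix.mul_smul, Matrix.smul_mul,
      Matrix.mul_vecMulVec, Matrix.vecMulVec_mul, hZv, hwZ, Matrix.smul_vecMulVec,
      Matrix.vecMulVec_smul]
  have h1 : g = 1 := by
    refine hfree g (Prod.ext ?_ ?_)
    · change (↑g⁻¹ : Matrix (Fin k) (Fin k) ℂ) * Z * (g : Matrix (Fin k) (Fin k) ℂ) = Z
      rw [Matrix.mul_assoc, hcomm, ← Matrix.mul_assoc, ← Units.val_mul, inv_mul_cancel,
        Units.val_one, Matrix.one_mul]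
    · change Ψ * (g : Matrix (Fin k) (Fin k) ℂ) = Ψ
      have h0 : Ψ *ᵥ v = 0 := by simpa using (hN' v).1 hvN 0
      rw [hgv, Matrix.mul_add, Matrix.mul_one, Matrix.mul_smul, Matrix.mul_vecMulVec, h0]
      ext; simp
  have h2 : Matrix.vecMulVec v w = 0 := by
    have h3 := congrArg (fun g : GL (Fin k) ℂ => (g : Matrix (Fin k) (Fin k) ℂ)) h1
    simp only [hgv, Units.val_one, add_eq_left, smul_eq_zero, ht, false_or] at h3
    exact h3
  obtain ⟨i, hi⟩ := Function.ne_iff.1 hv0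
  obtain ⟨j, hj⟩ := Function.ne_iff.1 hw0
  exact mul_ne_zero hi hj (congrFun (congrFun h2 i) j)

/-- Pairs with the same lattice can be moved to the same normal form. -/
lemma gEquiv_iff {x y : FreeData n k} : GEquiv x y ↔ latA x.1 = latA y.1 := by
  constructor
  · rintro ⟨g, hg⟩
    rw [hg, latA_gaugeAct]
  · intro h
    obtain ⟨l, T, hT, -⟩ := exists_latA_eq_patchMat (ev_surjective x) _ (Or.inl rfl)
    obtain ⟨g, hg⟩ := exists_gaugeAct_of_latA_eq hT
    obtain ⟨g', hg'⟩ := exists_gaugeAct_of_latA_eq (h.symm.trans hT)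
    refine ⟨g * g'⁻¹, ?_⟩
    rw [← gaugeAct_gaugeAct, hg, ← hg', gaugeAct_gaugeAct, mul_inv_cancel, gaugeAct_one]

/-! ## The bijection of the moduli spaces -/

/-- The lattice of a point of `𝓜`. -/
def ModM.lat : ModM n k → Submodule ℂ[X] (Fin n → ℂ[X]) :=
  Quotient.lift (fun D => latM D.1) fun _ _ h => vEquiv_iff.1 h

/-- The lattice of a point of `𝓜̃`. -/
def ModA.lat : ModA n k → Submodule ℂ[X] (Fin n → ℂ[X]) :=
  Quotient.lift (fun x => latA x.1) fun _ _ h => gEquiv_iff.1 h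

lemma ModM.lat_mk (D : PolyMat n k) : (ModM.mk D).lat = latM D.1 := rfl

lemma ModA.lat_mk (x : FreeData n k) : (ModA.mk x).lat = latA x.1 := rfl

lemma ModM.lat_injective : Function.Injective (ModM.lat (n := n) (k := k)) := by
  rintro ⟨D⟩ ⟨D'⟩ h
  exact Quotient.sound (vEquiv_iff.2 h)

lemma ModA.lat_injective : Function.Injective (ModA.lat (n := n) (k := k)) := by
  rintro ⟨x⟩ ⟨y⟩ h
  exact Quotient.sound (gEquiv_iff.2 h)

lemma lat_paramA (l : Idx n k) (T : Coord n k) : (paramA l T).lat = latM (patchMat l T) :=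
  latA_patchData l T

lemma exists_eq_paramM (m : ModM n k) (r : Fin n → Fin n → Prop)
    (hr : r = (fun a b => a ≤ b) ∨ r = (fun a b => b ≤ a)) :
    ∃ (l : Idx n k) (T : Coord n k), m = paramM l T ∧
      ∀ a b, ¬ r b a → ∀ m, T a (l.pos ⟨b, m⟩) = 0 := by
  obtain ⟨D, rfl⟩ := Quotient.exists_rep m
  obtain ⟨l, T, h, hT⟩ := exists_latM_eq_patchMat D r hr
  exact ⟨l, T, ModM.lat_injective h, hT⟩

lemma exists_eq_paramA (m : ModA n k) (r : Fin n → Fin n → Prop)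
    (hr : r = (fun a b => a ≤ b) ∨ r = (fun a b => b ≤ a)) :
    ∃ (l : Idx n k) (T : Coord n k), m = paramA l T ∧
      ∀ a b, ¬ r b a → ∀ m, T a (l.pos ⟨b, m⟩) = 0 := by
  obtain ⟨x, rfl⟩ := Quotient.exists_rep m
  obtain ⟨l, T, h, hT⟩ := exists_latA_eq_patchMat (ev_surjective x) r hr
  exact ⟨l, T, ModA.lat_injective (h.trans (lat_paramA l T).symm), hT⟩

lemma exists_modA_lat_eq (m : ModM n k) : ∃ y : ModA n k, y.lat = m.lat := by
  obtain ⟨l, T, rfl, -⟩ := exists_eq_paramM m _ (Or.inl rfl)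
  exact ⟨paramA l T, lat_paramA l T⟩

/-- The bijection between points of the moduli spaces with the same lattice. -/
def equivMA (n k : ℕ) : ModM n k ≃ ModA n k :=
  Equiv.ofBijective (fun m => (exists_modA_lat_eq m).choose) <| by
    have h : ∀ m : ModM n k, (exists_modA_lat_eq m).choose.lat = m.lat :=
      fun m => (exists_modA_lat_eq m).choose_spec
    constructor
    · intro m m' hm
      exact ModM.lat_injective (by rw [← h m, ← h m']; exact congrArg ModA.lat hm)
    · intro y
      obtain ⟨l, T, rfl, -⟩ := exists_eq_paramA y _ (Or.inl rfl)
      exact ⟨paramM l T, ModA.lat_injective ((h _).trans (lat_paramA l T).symm)⟩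

lemma lat_equivMA (m : ModM n k) : (equivMA n k m).lat = m.lat :=
  (exists_modA_lat_eq m).choose_spec

lemma equivMA_eq_iff {m : ModM n k} {y : ModA n k} : equivMA n k m = y ↔ m.lat = y.lat :=
  ⟨fun h => by rw [← h, lat_equivMA], fun h => ModA.lat_injective ((lat_equivMA m).trans h)⟩

lemma equivMA_paramM (l : Idx n k) (T : Coord n k) : equivMA n k (paramM l T) = paramA l T :=
  equivMA_eq_iff.2 (lat_paramA l T).symm

/-! ## The relation `D Ψ = J (z - Z)` -/

/-- The `q`-th term is `z^{m-q} s_q - z^{m-q-1} s_{q+1}`. The range extends to `L` because the sum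
will run over a whole block, where the terms with `q ≥ m` vanish. -/
lemma sum_telescope (s : ℕ → ℂ[X]) (L m : ℕ) (h : m ≤ L) :
    ∑ q : Fin L, (if (q : ℕ) < m then (X : ℂ[X]) ^ (m - q - 1) else 0) *
      (X * s q - s (q + 1)) = X ^ m * s 0 - s m := by
  rw [Fin.sum_univ_eq_sum_range
    (fun q => (if q < m then (X : ℂ[X]) ^ (m - q - 1) else 0) * (X * s q - s (q + 1))) L,
    ← Finset.sum_subset (Finset.range_subset_range.2 h)]
  · have := Finset.sum_range_sub' (fun q => (X : ℂ[X]) ^ (m - q) * s q) m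
    rw [Nat.sub_zero, Nat.sub_self, pow_zero, one_mul] at this
    rw [← this]
    refine Finset.sum_congr rfl fun q hq => ?_
    have hq' := Finset.mem_range.1 hq
    rw [if_pos hq', show m - q = (m - q - 1) + 1 by omega, show m - (q + 1) = m - q - 1 by omega]
    simp only [Nat.add_sub_cancel]
    ring
  · intro q _ hq
    rw [if_neg (fun h => hq (Finset.mem_range.2 h)), zero_mul]

lemma patchJ_apply (l : Idx n k) (T : Coord n k) (a b : Fin n) (p : Fin (l.1 b)) :
    patchJ l T a (l.pos ⟨b, p⟩) =
      (if a = b then (if (p : ℕ) < l.1 b then X ^ (l.1 b - p - 1) else 0) else 0) -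
      ∑ m : Fin (l.1 b), C (T a (l.pos ⟨b, m⟩)) *
        (if (p : ℕ) < m then X ^ ((m : ℕ) - p - 1) else 0) := by
  rw [patchJ, Matrix.of_apply, Equiv.symm_apply_apply, if_pos p.2]
  congr 1
  · by_cases h : a = b
    · subst h
      rw [if_pos rfl, if_pos rfl, Nat.sub_right_comm]
    · rw [if_neg h, if_neg h]
  · refine Finset.sum_congr rfl fun m _ => ?_
    rw [mul_ite, mul_zero]

section PatchEntries

variable (l : Idx n k) (T : Coord n k)

/-- The entries of a stack, as constant polynomials. -/
def stackC (j : Fin k) (c : Fin n) (p : ℕ) : ℂ[X] := C (stackRow l T c p j)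

lemma stackC_unit (j : Fin k) (c : Fin n) (q : Fin (l.1 c)) :
    stackC l T j c q = if l.pos ⟨c, q⟩ = j then 1 else 0 := by
  rw [stackC, stackRow, dif_pos q.2, Pi.single_apply]
  by_cases h : l.pos ⟨c, q⟩ = j
  · rw [if_pos h, if_pos h.symm, C_1]
  · rw [if_neg h, if_neg (Ne.symm h), C_0]

lemma stackC_last (j : Fin k) (c : Fin n) : stackC l T j c (l.1 c) = C (T c j) := by
  rw [stackC, stackRow, dif_neg (lt_irrefl _)]

/-- Consecutive stack rows appear here: the unit row at `(c, q)` is stack row `q`, and the same row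
of `Z` is stack row `q + 1`. -/
lemma X_smul_one_sub_patchData (j : Fin k) (c : Fin n) (q : Fin (l.1 c)) :
    ((X : ℂ[X]) • (1 : Matrix (Fin k) (Fin k) ℂ[X]) - (patchData l T).1.map C) (l.pos ⟨c, q⟩) j =
      X * stackC l T j c q - stackC l T j c (q + 1) := by
  have hZ : (patchData l T).1 (l.pos ⟨c, q⟩) j = stackRow l T c (q + 1) j := by
    change stackRow l T (l.pos.symm (l.pos ⟨c, q⟩)).1
      ((l.pos.symm (l.pos ⟨c, q⟩)).2 + 1) j = _
    rw [Equiv.symm_apply_apply]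
  rw [Matrix.sub_apply, Matrix.smul_apply, Matrix.map_apply, hZ, stackC_unit, smul_eq_mul,
    Matrix.one_apply, stackC]

/-- A monomial `z^m` of `D_λ` contributes to `J` the polynomial parts of `z^m / z^{q+1}`, exactly
the weights in `sum_telescope`. -/
lemma sum_patchJ_block (s : ℕ → ℂ[X]) (a c : Fin n) :
    ∑ q : Fin (l.1 c), patchJ l T a (l.pos ⟨c, q⟩) * (X * s q - s (q + 1)) =
      (if a = c then X ^ l.1 c * s 0 - s (l.1 c) else 0) -
        ∑ m : Fin (l.1 c), C (T a (l.pos ⟨c, m⟩)) * (X ^ (m : ℕ) * s 0 - s m) := by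
  have h1 : ∑ q : Fin (l.1 c), (if a = c then
      (if (q : ℕ) < l.1 c then (X : ℂ[X]) ^ (l.1 c - q - 1) else 0) else 0) *
        (X * s q - s (q + 1)) = if a = c then X ^ l.1 c * s 0 - s (l.1 c) else 0 := by
    by_cases h : a = c
    · rw [if_pos h, ← sum_telescope s _ _ le_rfl]
      exact Finset.sum_congr rfl fun q _ => by rw [if_pos h]
    · rw [if_neg h]
      exact Finset.sum_eq_zero fun q _ => by rw [if_neg h, zero_mul]
  have h2 : ∑ q : Fin (l.1 c), (∑ m : Fin (l.1 c), C (T a (l.pos ⟨c, m⟩)) *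
      (if (q : ℕ) < m then (X : ℂ[X]) ^ ((m : ℕ) - q - 1) else 0)) * (X * s q - s (q + 1)) =
        ∑ m : Fin (l.1 c), C (T a (l.pos ⟨c, m⟩)) * (X ^ (m : ℕ) * s 0 - s m) := by
    simp only [Finset.sum_mul]
    rw [Finset.sum_comm]
    refine Finset.sum_congr rfl fun m _ => ?_
    rw [← sum_telescope s _ _ m.2.le, Finset.mul_sum]
    exact Finset.sum_congr rfl fun q _ => mul_assoc _ _ _
  rw [← h1, ← h2, ← Finset.sum_sub_distrib]
  exact Finset.sum_congr rfl fun q _ => by rw [patchJ_apply, sub_mul]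

lemma patchJ_mul_apply (a : Fin n) (j : Fin k) :
    (patchJ l T * ((X : ℂ[X]) • (1 : Matrix (Fin k) (Fin k) ℂ[X]) -
      (patchData l T).1.map C)) a j =
      ∑ c, ((if a = c then X ^ l.1 c * stackC l T j c 0 - stackC l T j c (l.1 c) else 0) -
        ∑ m : Fin (l.1 c), C (T a (l.pos ⟨c, m⟩)) *
          (X ^ (m : ℕ) * stackC l T j c 0 - stackC l T j c m)) := by
  rw [Matrix.mul_apply, ← l.pos.sum_comp, Fintype.sum_sigma]
  refine Finset.sum_congr rfl fun c _ => ?_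
  rw [← sum_patchJ_block]
  exact Finset.sum_congr rfl fun q _ => by rw [X_smul_one_sub_patchData]

lemma patchMat_mul_apply (a : Fin n) (j : Fin k) :
    (patchMat l T * (patchData l T).2.map C) a j =
      ∑ c, ((if a = c then X ^ l.1 c * stackC l T j c 0 else 0) -
        ∑ m : Fin (l.1 c), C (T a (l.pos ⟨c, m⟩)) * (X ^ (m : ℕ) * stackC l T j c 0)) := by
  rw [Matrix.mul_apply]
  refine Finset.sum_congr rfl fun c _ => ?_
  have h1 : ((patchData l T).2.map C) c j = stackC l T j c 0 := rfl
  rw [h1, patchMat, Matrix.sub_apply, Matrix.of_apply, Matrix.diagonal_apply, sub_mul,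
    Finset.sum_mul, ite_mul, zero_mul]
  congr 1
  · by_cases h : a = c
    · subst h; rfl
    · rw [if_neg h, if_neg h]
  · exact Finset.sum_congr rfl fun m _ => mul_assoc _ _ _

/-- These are the lower ends of the telescoping sums; they reassemble `T_a` and cancel the last row
of the `a`-th stack. -/
lemma sum_mul_stackC (a : Fin n) (j : Fin k) :
    ∑ c, ∑ m : Fin (l.1 c), C (T a (l.pos ⟨c, m⟩)) * stackC l T j c m = C (T a j) := by
  simp only [stackC_unit]
  rw [← Fintype.sum_sigma' (fun c (m : Fin (l.1 c)) =>
    C (T a (l.pos ⟨c, m⟩)) * if l.pos ⟨c, m⟩ = j then 1 else 0)]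
  exact (l.pos.sum_comp (fun i => C (T a i) * if i = j then 1 else 0)).trans (by simp)

theorem rel_patch : Rel ⟨patchMat l T, patchMat_det_degree l T⟩ (patchJ l T)
    ⟨patchData l T, patchData_free l T⟩ := by
  refine Matrix.ext fun a j => ?_
  refine (patchMat_mul_apply l T a j).trans (Eq.trans ?_ (patchJ_mul_apply l T a j).symm)
  simp only [mul_sub, Finset.sum_sub_distrib, Finset.sum_ite_eq, Finset.mem_univ, if_true]
  rw [sum_mul_stackC, stackC_last]
  ring

end PatchEntries

lemma Rel.mul_left {D D' : PolyMat n k} {J : Matrix (Fin n) (Fin k) ℂ[X]} {x : FreeData n k}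
    (h : Rel D J x) {V : Matrix (Fin n) (Fin n) ℂ[X]} (hV : D'.1 = V * D.1) :
    Rel D' (V * J) x := by
  rw [Rel] at *
  rw [hV, Matrix.mul_assoc, h, Matrix.mul_assoc]

lemma mul_mul_eq_of_mul_eq {R : Type*} [CommRing R] {D : Matrix (Fin n) (Fin n) R}
    {Ψ J : Matrix (Fin n) (Fin k) R} {Z G G' : Matrix (Fin k) (Fin k) R} {t : R}
    (h : D * Ψ = J * (t • 1 - Z)) (hG : G * G' = 1) :
    D * (Ψ * G) = J * G * (t • 1 - G' * Z * G) := by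
  have h1 : G * (t • 1 - G' * Z * G) = (t • 1 - Z) * G := by
    rw [Matrix.mul_sub, Matrix.mul_smul, Matrix.mul_one, Matrix.sub_mul, Matrix.smul_mul,
      Matrix.one_mul, ← Matrix.mul_assoc, ← Matrix.mul_assoc, hG, Matrix.one_mul]
  rw [Matrix.mul_assoc J, h1, ← Matrix.mul_assoc, h, Matrix.mul_assoc]

lemma Rel.gauge {D : PolyMat n k} {J : Matrix (Fin n) (Fin k) ℂ[X]} {x y : FreeData n k}
    (h : Rel D J x) {g : GL (Fin k) ℂ} (hg : y.1 = gaugeAct g x.1) :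
    Rel D (J * (g : Matrix (Fin k) (Fin k) ℂ).map C) y := by
  have hinv : (g : Matrix (Fin k) (Fin k) ℂ).map C * (↑g⁻¹ : Matrix (Fin k) (Fin k) ℂ).map C
      = (1 : Matrix (Fin k) (Fin k) ℂ[X]) := by
    rw [← Matrix.map_mul, ← Units.val_mul, mul_inv_cancel, Units.val_one]
    exact Matrix.map_one _ C_0 C_1
  have h1 : y.1.1.map C = (↑g⁻¹ : Matrix (Fin k) (Fin k) ℂ).map C * x.1.1.map C *
      (g : Matrix (Fin k) (Fin k) ℂ).map C := by
    rw [hg, ← Matrix.map_mul, ← Matrix.map_mul]; rfl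
  have h2 : y.1.2.map C = x.1.2.map C * (g : Matrix (Fin k) (Fin k) ℂ).map C := by
    rw [hg, ← Matrix.map_mul]; rfl
  rw [Rel, h1, h2]
  exact mul_mul_eq_of_mul_eq h hinv

/-- Substituting `Z` for `z`, with its powers to the right of the coefficient rows, kills any right
multiple of `z - Z`, as in the Cayley–Hamilton argument. -/
lemma Rel.latM_le {D : PolyMat n k} {J : Matrix (Fin n) (Fin k) ℂ[X]} {x : FreeData n k}
    (h : Rel D J x) : latM D.1 ≤ latA x.1 := by
  obtain ⟨⟨Z, Ψ⟩, hx⟩ := x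
  refine HalfADHM.latM_le fun a => ?_
  rw [mem_latA, ev_apply]
  ext i
  have h1 : ∀ j, ∑ b, D.1 a b * C (Ψ b j) = X * J a j - ∑ m, J a m * C (Z m j) := by
    intro j
    have := congrFun (congrFun h a) j
    rw [Matrix.mul_sub, Matrix.mul_smul, Matrix.mul_one] at this
    exact this
  calc (∑ b, Ψ b ᵥ* aeval Z (D.1 a b)) i
      = ∑ b, ∑ j, Ψ b j * aeval Z (D.1 a b) j i := by
        rw [Finset.sum_apply]; rfl
    _ = ∑ j, aeval Z (∑ b, D.1 a b * C (Ψ b j)) j i := by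
        rw [Finset.sum_comm]
        refine Finset.sum_congr rfl fun j _ => ?_
        rw [map_sum, Matrix.sum_apply]
        refine Finset.sum_congr rfl fun b _ => ?_
        rw [mul_comm (D.1 a b), ← smul_eq_C_mul, map_smul, Matrix.smul_apply, smul_eq_mul]
    _ = ∑ j, (Z * aeval Z (J a j)) j i - ∑ m, ∑ j, Z m j * aeval Z (J a m) j i := by
        rw [Finset.sum_comm (s := Finset.univ (α := Fin k)), ← Finset.sum_sub_distrib]
        refine Finset.sum_congr rfl fun j _ => ?_
        rw [h1, map_sub, map_mul, aeval_X, Matrix.sub_apply, map_sum, Matrix.sum_apply]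
        congr 1
        refine Finset.sum_congr rfl fun m _ => ?_
        rw [mul_comm (J a m), ← smul_eq_C_mul, map_smul, Matrix.smul_apply, smul_eq_mul]
    -- Expanding the matrix product `Z * aeval Z (J a j)` turns the first sum into the second, up to
    -- names of the indices.
    _ = 0 := sub_self _

/-- Both lattices have codimension `k`. Concretely, low vectors represent everything modulo `latM
D`, so the frame of `x` spans `ℂ^k`; being square it is invertible. -/
lemma latM_eq_latA_of_le {D : PolyMat n k} {x : FreeData n k} (h : latM D.1 ≤ latA x.1) :
    latM D.1 = latA x.1 := by
  obtain ⟨l, T, hD, -⟩ := exists_latM_eq_patchMat D _ (Or.inl rfl)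
  rw [hD] at h ⊢
  refine (eq_latM_patchMat l T _ (fun a => ?_) fun c hc => ?_).symm
  · rw [← patchMat_row]; exact h (row_mem_latM _ a)
  · have hsurj : Function.Surjective (Matrix.vecMulLinear (frameMat l x.1)) := by
      intro v
      obtain ⟨f, rfl⟩ := ev_surjective x v
      obtain ⟨c, hc⟩ := exists_sub_low_mem l T f
      have h1 := mem_latA.1 (h hc)
      rw [map_sub, sub_eq_zero, ev_low] at h1
      exact ⟨c, h1.symm⟩
    refine LinearMap.injective_iff_surjective.2 hsurj ?_
    rw [mem_latA, ev_low] at hc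
    rw [Matrix.vecMulLinear_apply, hc, map_zero]

theorem exists_rel_iff {D : PolyMat n k} {x : FreeData n k} :
    (∃ J, Rel D J x) ↔ latM D.1 = latA x.1 := by
  constructor
  · rintro ⟨J, hJ⟩
    exact latM_eq_latA_of_le hJ.latM_le
  · intro h
    obtain ⟨l, T, hD, -⟩ := exists_latM_eq_patchMat D _ (Or.inl rfl)
    obtain ⟨V, hV⟩ := vEquiv_iff.2
      (show latM (⟨patchMat l T, patchMat_det_degree l T⟩ : PolyMat n k).1 = latM D.1 from hD.symm)
    obtain ⟨g, hg⟩ := gEquiv_iff.2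
      (show latA (⟨patchData l T, patchData_free l T⟩ : FreeData n k).1 = latA x.1 by
        rw [latA_patchData, ← h, hD])
    exact ⟨_, ((rel_patch l T).mul_left hV).gauge hg⟩

theorem equivMA_mk_eq_mk_iff {D : PolyMat n k} {x : FreeData n k} :
    equivMA n k (ModM.mk D) = ModA.mk x ↔ ∃ J, Rel D J x := by
  rw [exists_rel_iff, equivMA_eq_iff, ModM.lat_mk, ModA.lat_mk]

/-! ## Topology of `𝓜̃` -/

lemma gaugeAct_free (g : GL (Fin k) ℂ) (x : FreeData n k) (h : GL (Fin k) ℂ)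
    (hh : gaugeAct h (gaugeAct g x.1) = gaugeAct g x.1) : h = 1 := by
  have h1 : gaugeAct (g * h * g⁻¹) x.1 = x.1 := by
    rw [← gaugeAct_gaugeAct, ← gaugeAct_gaugeAct, hh, gaugeAct_gaugeAct, mul_inv_cancel,
      gaugeAct_one]
  have h2 := x.2 _ h1
  rwa [mul_inv_eq_one, mul_eq_left] at h2

/-- The action on free pairs. -/
def gaugeFree (g : GL (Fin k) ℂ) (x : FreeData n k) : FreeData n k :=
  ⟨gaugeAct g x.1, gaugeAct_free g x⟩

lemma continuous_gaugeAct (g : GL (Fin k) ℂ) : Continuous (gaugeAct (n := n) g) := by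
  unfold gaugeAct
  fun_prop

lemma mk_eq_mk_iff {x y : FreeData n k} : ModA.mk x = ModA.mk y ↔ GEquiv x y :=
  ⟨fun h => Quotient.exact h, fun h => Quotient.sound h⟩

/-- The saturation of an open set is the union of its preimages under the group elements. -/
lemma isOpenQuotientMap_mk : IsOpenQuotientMap (ModA.mk (n := n) (k := k)) := by
  have hq : IsQuotientMap (ModA.mk (n := n) (k := k)) := isQuotientMap_quotient_mk'
  refine ⟨hq.surjective, hq.continuous, fun U hU => ?_⟩
  rw [← hq.isOpen_preimage]
  have : ModA.mk ⁻¹' (ModA.mk '' U) = ⋃ g : GL (Fin k) ℂ, gaugeFree g ⁻¹' U := by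
    ext x
    simp only [mem_preimage, mem_image, mem_iUnion]
    constructor
    · rintro ⟨y, hy, hyx⟩
      obtain ⟨g, hg⟩ := mk_eq_mk_iff.1 hyx.symm
      refine ⟨g, ?_⟩
      rwa [show gaugeFree g x = y from Subtype.ext hg.symm]
    · rintro ⟨g, hg⟩
      exact ⟨_, hg, (mk_eq_mk_iff.2 ⟨g, rfl⟩ : ModA.mk x = _).symm⟩
  rw [this]
  refine isOpen_iUnion fun g => hU.preimage ?_
  exact ((continuous_gaugeAct g).comp continuous_subtype_val).subtype_mk _

lemma continuous_frameMat (l : Idx n k) : Continuous (frameMat (n := n) l) := by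
  refine continuous_matrix fun i j => ?_
  exact Continuous.matrix_elem (A := fun x : Data n k => x.2 * x.1 ^ ((l.pos.symm i).2 : ℕ))
    (by fun_prop) _ _

lemma exists_frameMat_det_ne_zero (x : FreeData n k) :
    ∃ l : Idx n k, (frameMat l x.1).det ≠ 0 := by
  obtain ⟨l, T, h, -⟩ := exists_latA_eq_patchMat (ev_surjective x) _ (Or.inl rfl)
  exact ⟨l, frameMat_det_ne_zero h⟩

/-- The orbit relation is defined by closed conditions. -/
lemma gEquiv_iff_forall_adjugate {x y : FreeData n k} : GEquiv x y ↔ ∀ l : Idx n k,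
    x.1.1 * ((frameMat l x.1).adjugate * frameMat l y.1) =
      (frameMat l x.1).adjugate * frameMat l y.1 * y.1.1 ∧
    x.1.2 * ((frameMat l x.1).adjugate * frameMat l y.1) = (frameMat l x.1).det • y.1.2 := by
  constructor
  · rintro ⟨g, hg⟩ l
    -- On an orbit the frames differ by `g`, so the equations are those of an intertwiner scaled by
    -- a determinant; they stay true where it vanishes.
    have hG : (frameMat l x.1).adjugate * frameMat l y.1 =
        (frameMat l x.1).det • (g : Matrix (Fin k) (Fin k) ℂ) := by
      rw [hg, frameMat_gaugeAct, ← Matrix.mul_assoc, Matrix.adjugate_mul, Matrix.smul_mul,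
        Matrix.one_mul]
    rw [hG, hg]
    refine ⟨?_, Matrix.mul_smul _ _ _⟩
    rw [Matrix.mul_smul, Matrix.smul_mul]
    simp only [gaugeAct]
    rw [Matrix.mul_assoc, ← Matrix.mul_assoc (g : Matrix (Fin k) (Fin k) ℂ), ← Units.val_mul,
      mul_inv_cancel, Units.val_one, Matrix.one_mul]
  · intro h
    obtain ⟨l, hl⟩ := exists_frameMat_det_ne_zero x
    obtain ⟨h1, h2⟩ := h l
    set G := (frameMat l x.1).det⁻¹ • ((frameMat l x.1).adjugate * frameMat l y.1) with hG
    have hZ : x.1.1 * G = G * y.1.1 := by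
      rw [hG, Matrix.mul_smul, Matrix.smul_mul, h1]
    have hΨ : x.1.2 * G = y.1.2 := by
      rw [hG, Matrix.mul_smul, h2, smul_smul, inv_mul_cancel₀ hl, one_smul]
    have hpow : ∀ p : ℕ, x.1.2 * x.1.1 ^ p * G = y.1.2 * y.1.1 ^ p := by
      intro p
      induction p with
      | zero => simpa using hΨ
      | succ p ih =>
        rw [pow_succ, ← Matrix.mul_assoc, Matrix.mul_assoc _ x.1.1, hZ, ← Matrix.mul_assoc, ih,
          Matrix.mul_assoc, ← pow_succ]
    obtain ⟨l', hl'⟩ := exists_frameMat_det_ne_zero y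
    have hfr : frameMat l' x.1 * G = frameMat l' y.1 := by
      refine funext fun i => ?_
      exact congrFun (hpow ((l'.pos.symm i).2 : ℕ)) (l'.pos.symm i).1
    -- `G` carries frames of `x` to frames of `y`; a chart containing `y`, possibly not `x`, shows
    -- that it is invertible.
    have hdet : G.det ≠ 0 := by
      intro h0
      rw [← hfr, Matrix.det_mul, h0, mul_zero] at hl'
      exact hl' rfl
    refine ⟨Matrix.GeneralLinearGroup.mkOfDetNeZero G hdet, ?_⟩
    set g := Matrix.GeneralLinearGroup.mkOfDetNeZero G hdet with hg
    have hgG : (g : Matrix (Fin k) (Fin k) ℂ) = G := rfl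
    refine Prod.ext ?_ ?_
    · change y.1.1 = (↑g⁻¹ : Matrix (Fin k) (Fin k) ℂ) * x.1.1 * (g : Matrix (Fin k) (Fin k) ℂ)
      rw [Matrix.mul_assoc, hgG, hZ, ← hgG, ← Matrix.mul_assoc, ← Units.val_mul, inv_mul_cancel,
        Units.val_one, Matrix.one_mul]
    · exact hΨ.symm

theorem t2Space_modA (n k : ℕ) : T2Space (ModA n k) := by
  rw [t2Space_iff_of_isOpenQuotientMap isOpenQuotientMap_mk]
  have : {q : FreeData n k × FreeData n k | ModA.mk q.1 = ModA.mk q.2} = ⋂ l : Idx n k,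
      {q : FreeData n k × FreeData n k | q.1.1.1 * ((frameMat l q.1.1).adjugate * frameMat l q.2.1) =
        (frameMat l q.1.1).adjugate * frameMat l q.2.1 * q.2.1.1} ∩
      {q : FreeData n k × FreeData n k | q.1.1.2 * ((frameMat l q.1.1).adjugate * frameMat l q.2.1) =
        (frameMat l q.1.1).det • q.2.1.2} := by
    ext q
    rw [mem_iInter]
    exact mk_eq_mk_iff.trans gEquiv_iff_forall_adjugate
  rw [this]
  refine isClosed_iInter fun l => ?_
  have h1 : Continuous fun q : FreeData n k × FreeData n k => frameMat l q.1.1 :=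
    (continuous_frameMat l).comp (continuous_subtype_val.comp continuous_fst)
  have h2 : Continuous fun q : FreeData n k × FreeData n k => frameMat l q.2.1 :=
    (continuous_frameMat l).comp (continuous_subtype_val.comp continuous_snd)
  have h3 := h1.matrix_adjugate.matrix_mul h2
  exact (isClosed_eq (Continuous.matrix_mul (by fun_prop) h3)
    (h3.matrix_mul (by fun_prop))).inter
    (isClosed_eq (Continuous.matrix_mul (by fun_prop) h3)
    (h1.matrix_det.smul (by fun_prop)))

theorem secondCountableTopology_modA (n k : ℕ) : SecondCountableTopology (ModA n k) := by
  have h1 (a b : ℕ) : SecondCountableTopology (Matrix (Fin a) (Fin b) ℂ) :=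
    inferInstanceAs (SecondCountableTopology (Fin a → Fin b → ℂ))
  have h2 : SecondCountableTopology (FreeData n k) :=
    TopologicalSpace.Subtype.secondCountableTopology _
  exact isOpenQuotientMap_mk.isQuotientMap.secondCountableTopology isOpenQuotientMap_mk.isOpenMap

/-! ## The coordinate patches -/

lemma continuous_stackRow (l : Idx n k) (a : Fin n) (p : ℕ) :
    Continuous fun T : Coord n k => stackRow l T a p := by
  unfold stackRow
  split_ifs
  · exact continuous_const
  · exact continuous_apply a

lemma continuous_patchData (l : Idx n k) : Continuous (patchData (n := n) l) := by
  refine Continuous.prodMk ?_ ?_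
  · exact continuous_pi fun i => continuous_stackRow l _ _
  · exact continuous_pi fun a => continuous_stackRow l _ _

lemma continuous_paramA (l : Idx n k) : Continuous (paramA (n := n) l) :=
  isOpenQuotientMap_mk.continuous.comp ((continuous_patchData l).subtype_mk _)

lemma paramA_injective (l : Idx n k) : Function.Injective (paramA (n := n) l) := by
  intro T T' h
  have := congrArg ModA.lat h
  rw [lat_paramA, lat_paramA] at this
  exact eq_of_latM_patchMat_eq this

lemma continuousOn_coordOf (l : Idx n k) :
    ContinuousOn (coordOf (n := n) l) {x | (frameMat l x).det ≠ 0} := by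
  refine continuousOn_pi.2 fun a => ?_
  unfold coordOf
  refine ContinuousOn.smul (f := fun x : Data n k => (frameMat l x).det⁻¹) ?_ ?_
  · exact (continuous_frameMat l).matrix_det.continuousOn.inv₀ fun x hx => hx
  · refine Continuous.continuousOn (Continuous.matrix_vecMul ?_
      (continuous_frameMat l).matrix_adjugate)
    have : Continuous fun x : Data n k => x.2 * x.1 ^ l.1 a := by fun_prop
    exact (continuous_apply a).comp this

/-- Identifies the chart domain upstairs as the open set where the frame determinant is nonzero,
with `coordOf` as coordinate. -/
lemma mk_eq_paramA_iff {l : Idx n k} {x : FreeData n k} {T : Coord n k} :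
    ModA.mk x = paramA l T ↔ (frameMat l x.1).det ≠ 0 ∧ coordOf l x.1 = T := by
  rw [← ModA.lat_injective.eq_iff, lat_paramA, ModA.lat_mk]
  constructor
  · exact fun h => ⟨frameMat_det_ne_zero h, coordOf_eq_of_latA_eq h⟩
  · rintro ⟨h, rfl⟩
    exact latA_eq_latM h

lemma isOpenEmbedding_paramA (l : Idx n k) : IsOpenEmbedding (paramA (n := n) l) := by
  refine IsOpenEmbedding.of_continuous_injective_isOpenMap (continuous_paramA l)
    (paramA_injective l) fun U hU => ?_
  rw [← isOpenQuotientMap_mk.isQuotientMap.isOpen_preimage]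
  have : ModA.mk ⁻¹' (paramA l '' U) = Subtype.val ⁻¹'
      ({x : Data n k | (frameMat l x).det ≠ 0} ∩ coordOf l ⁻¹' U) := by
    ext x
    constructor
    · rintro ⟨T, hT, h⟩
      obtain ⟨h1, rfl⟩ := mk_eq_paramA_iff.1 h.symm
      exact ⟨h1, hT⟩
    · rintro ⟨h1, h2⟩
      exact ⟨_, h2, (mk_eq_paramA_iff.2 ⟨h1, rfl⟩).symm⟩
  rw [this]
  refine ((continuousOn_coordOf l).isOpen_inter_preimage ?_ hU).preimage continuous_subtype_val
  exact isOpen_ne.preimage (continuous_frameMat l).matrix_det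

/-! ## Topology of `𝓜` -/

lemma continuous_paramM (l : Idx n k) : Continuous (paramM (n := n) l) :=
  continuous_iff_coinduced_le.2 (le_iSup (fun l : Idx n k =>
    TopologicalSpace.coinduced (paramM l) inferInstance) l)

lemma continuous_equivMA (n k : ℕ) : Continuous (equivMA n k) := by
  refine continuous_iSup_dom.2 fun l => continuous_coinduced_dom.2 ?_
  have : ⇑(equivMA n k) ∘ paramM l = paramA l := funext fun T => equivMA_paramM l T
  rw [this]
  exact continuous_paramA l

/-- An open set of `𝓜` is covered by its chart pieces, and the parametrizations of `𝓜̃` are open;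
the topology of `𝓜` is then inherited from `𝓜̃`. -/
lemma isOpenMap_equivMA (n k : ℕ) : IsOpenMap (equivMA n k) := by
  intro U hU
  have : equivMA n k '' U = ⋃ l : Idx n k, paramA l '' (paramM l ⁻¹' U) := by
    ext y
    simp only [mem_iUnion, mem_image, mem_preimage]
    constructor
    · rintro ⟨m, hm, rfl⟩
      obtain ⟨l, T, rfl, -⟩ := exists_eq_paramM m _ (Or.inl rfl)
      exact ⟨l, T, hm, (equivMA_paramM l T).symm⟩
    · rintro ⟨l, T, hT, rfl⟩
      exact ⟨_, hT, equivMA_paramM l T⟩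
  rw [this]
  exact isOpen_iUnion fun l => (isOpenEmbedding_paramA l).isOpenMap _
    (hU.preimage (continuous_paramM l))

/-- The homeomorphism of the moduli spaces. -/
def homeoMA (n k : ℕ) : ModM n k ≃ₜ ModA n k :=
  (equivMA n k).toHomeomorphOfContinuousOpen (continuous_equivMA n k) (isOpenMap_equivMA n k)

lemma homeoMA_apply (m : ModM n k) : homeoMA n k m = equivMA n k m := rfl

lemma isOpenEmbedding_paramM (l : Idx n k) : IsOpenEmbedding (paramM (n := n) l) := by
  have : paramM l = ⇑(homeoMA n k).symm ∘ paramA l := by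
    funext T
    rw [Function.comp_apply, ← equivMA_paramM, ← homeoMA_apply, Homeomorph.symm_apply_apply]
  rw [this]
  exact (homeoMA n k).symm.isOpenEmbedding.comp (isOpenEmbedding_paramA l)

theorem t2Space_modM (n k : ℕ) : T2Space (ModM n k) :=
  have := t2Space_modA n k
  (homeoMA n k).symm.t2Space

theorem secondCountableTopology_modM (n k : ℕ) : SecondCountableTopology (ModM n k) :=
  have := secondCountableTopology_modA n k
  (homeoMA n k).secondCountableTopology

/-! ## Atlases from parametrizations -/

section Atlas

variable {M : Type} [TopologicalSpace M] {param : Idx n k → Coord n k → M}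

lemma exists_hasAtlas (hemb : ∀ l, IsOpenEmbedding (param l))
    (hcov : ∀ m, ∃ l T, m = param l T) :
    ∃ c : ChartedSpace (Coord n k) M, HasAtlas c param := by
  set φ : Idx n k → OpenPartialHomeomorph M (Coord n k) :=
    fun l => ((hemb l).toOpenPartialHomeomorph (param l)).symm
  choose i T hiT using hcov
  refine ⟨⟨Set.range φ, fun m => φ (i m), fun m => ?_, fun m => ⟨i m, rfl⟩⟩, φ, rfl, fun l => ?_⟩
  · simp only [φ, OpenPartialHomeomorph.symm_source, IsOpenEmbedding.toOpenPartialHomeomorph_target]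
    exact ⟨T m, (hiT m).symm⟩
  · refine ⟨?_, ?_, fun T => rfl⟩
    · simp [φ]
    · simp [φ]

lemma isManifold_of_hasAtlas {c : ChartedSpace (Coord n k) M} (h : HasAtlas c param)
    (tr : Idx n k → Idx n k → Coord n k → Coord n k)
    (htr : ∀ l l', ContDiffOn ℂ ω (tr l l') {T | param l T ∈ range (param l')})
    (hpar : ∀ l l' T, param l T ∈ range (param l') → param l' (tr l l' T) = param l T) :
    IsManifold 𝓘(ℂ, Coord n k) ω M := by
  obtain ⟨φ, hφ, hφ'⟩ := h
  refine isManifold_of_contDiffOn _ _ _ fun e e' he he' => ?_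
  have hat : atlas (Coord n k) M = range φ := hφ
  rw [hat] at he he'
  obtain ⟨l, rfl⟩ := he
  obtain ⟨l', rfl⟩ := he'
  have hsub : (((φ l).symm ≫ₕ φ l').source : Set (Coord n k)) ⊆
      {T | param l T ∈ range (param l')} := by
    intro T hT
    rw [OpenPartialHomeomorph.trans_source] at hT
    have := hT.2
    rwa [mem_preimage, (hφ' l').1, (hφ' l).2.2] at this
  have hmain : ContDiffOn ℂ ω ((φ l).symm ≫ₕ φ l') ((φ l).symm ≫ₕ φ l').source := by
    refine ((htr l l').mono hsub).congr fun T hT => ?_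
    change φ l' ((φ l).symm T) = _
    -- Any map `tr` giving the same point in the chart `l'` is the chart change, since `φ l'`
    -- inverts `param l'`.
    rw [(hφ' l).2.2, ← hpar l l' T (hsub hT), ← (hφ' l').2.2 (tr l l' T), (φ l').right_inv]
    rw [(hφ' l').2.1]; trivial
  simpa using hmain

lemma contMDiff_of_hasAtlas {N : Type} [TopologicalSpace N] {param' : Idx n k → Coord n k → N}
    {c : ChartedSpace (Coord n k) M} {c' : ChartedSpace (Coord n k) N}
    (h : HasAtlas c param) (h' : HasAtlas c' param')
    [IsManifold 𝓘(ℂ, Coord n k) ω M] [IsManifold 𝓘(ℂ, Coord n k) ω N]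
    (hcov : ∀ m, ∃ l T, m = param l T) (F : M → N) (hF : ∀ l T, F (param l T) = param' l T) :
    ContMDiff 𝓘(ℂ, Coord n k) 𝓘(ℂ, Coord n k) ω F := by
  obtain ⟨φ, hφ, hφ'⟩ := h
  obtain ⟨ψ, hψ, hψ'⟩ := h'
  intro m
  obtain ⟨l, T, rfl⟩ := hcov m
  have h1 : ContMDiffOn 𝓘(ℂ, Coord n k) 𝓘(ℂ, Coord n k) ω (φ l) (φ l).source :=
    contMDiffOn_of_mem_maximalAtlas (IsManifold.subset_maximalAtlas (hφ.ge (mem_range_self l)))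
  have h2 : ContMDiffOn 𝓘(ℂ, Coord n k) 𝓘(ℂ, Coord n k) ω (ψ l).symm (ψ l).target :=
    contMDiffOn_symm_of_mem_maximalAtlas (IsManifold.subset_maximalAtlas (hψ.ge (mem_range_self l)))
  have h3 := h2.comp h1 (fun x _ => by rw [mem_preimage, (hψ' l).2.1]; trivial)
  have h4 : ContMDiffOn 𝓘(ℂ, Coord n k) 𝓘(ℂ, Coord n k) ω F (φ l).source := by
    refine h3.congr fun x hx => ?_
    rw [Function.comp_apply, (hψ' l).2.2, ← hF, ← (hφ' l).2.2, (φ l).left_inv hx]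
  refine h4.contMDiffAt ((φ l).open_source.mem_nhds ?_)
  rw [(hφ' l).1]
  exact mem_range_self T

end Atlas

/-! ## Analyticity of the transition functions -/

section Entries

variable {E ι κ μ : Type*} [NormedAddCommGroup E] [NormedSpace ℂ E] [Fintype κ]

lemma contDiff_matrix_mul {A : E → Matrix ι κ ℂ} {B : E → Matrix κ μ ℂ}
    (hA : ∀ i j, ContDiff ℂ ω fun e => A e i j) (hB : ∀ i j, ContDiff ℂ ω fun e => B e i j)
    (i : ι) (j : μ) : ContDiff ℂ ω fun e => (A e * B e) i j := by
  simp only [Matrix.mul_apply]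
  exact ContDiff.sum fun m _ => (hA i m).mul (hB m j)

lemma contDiff_matrix_pow [DecidableEq κ] {A : E → Matrix κ κ ℂ}
    (hA : ∀ i j, ContDiff ℂ ω fun e => A e i j) (p : ℕ) (i j : κ) :
    ContDiff ℂ ω fun e => (A e ^ p) i j := by
  induction p generalizing i j with
  | zero => simp only [pow_zero]; exact contDiff_const
  | succ p ih => simp only [pow_succ]; exact contDiff_matrix_mul ih hA i j

lemma contDiff_matrix_det [DecidableEq κ] {A : E → Matrix κ κ ℂ}
    (hA : ∀ i j, ContDiff ℂ ω fun e => A e i j) : ContDiff ℂ ω fun e => (A e).det := by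
  simp only [Matrix.det_apply']
  exact ContDiff.sum fun σ _ => contDiff_const.mul (contDiff_prod fun i _ => hA _ _)

lemma contDiff_matrix_adjugate [DecidableEq κ] {A : E → Matrix κ κ ℂ}
    (hA : ∀ i j, ContDiff ℂ ω fun e => A e i j) (i j : κ) :
    ContDiff ℂ ω fun e => (A e).adjugate i j := by
  simp only [Matrix.adjugate_apply]
  refine contDiff_matrix_det fun a b => ?_
  simp only [Matrix.updateRow_apply]
  split_ifs
  · exact contDiff_const
  · exact hA a b

end Entries

lemma contDiff_stackRow (l : Idx n k) (a : Fin n) (p : ℕ) (j : Fin k) :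
    ContDiff ℂ ω fun T : Coord n k => stackRow l T a p j := by
  unfold stackRow
  split_ifs
  · exact contDiff_const
  · exact contDiff_apply_apply ℂ ℂ a j

lemma contDiff_patchData_row (l : Idx n k) (p : ℕ) (a : Fin n) (j : Fin k) :
    ContDiff ℂ ω fun T : Coord n k => ((patchData l T).2 * (patchData l T).1 ^ p) a j :=
  contDiff_matrix_mul (fun _ _ => contDiff_stackRow l _ _ _)
    (contDiff_matrix_pow (fun _ _ => contDiff_stackRow l _ _ _) p) a j

/-- The coordinate change from the chart `l` to the chart `l'` is holomorphic. -/
lemma contDiffOn_coordOf_patchData (l l' : Idx n k) :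
    ContDiffOn ℂ ω (fun T : Coord n k => coordOf l' (patchData l T))
      {T | (frameMat l' (patchData l T)).det ≠ 0} := by
  have hB : ∀ i j, ContDiff ℂ ω fun T : Coord n k => frameMat l' (patchData l T) i j :=
    fun i j => contDiff_patchData_row l _ _ j
  refine contDiffOn_pi.2 fun a => contDiffOn_pi.2 fun j => ?_
  simp only [coordOf, Pi.smul_apply, smul_eq_mul]
  refine ContDiffOn.mul ((contDiff_matrix_det hB).contDiffOn.inv fun T hT => hT) ?_
  refine ContDiff.contDiffOn ?_
  simp only [Matrix.vecMul, dotProduct]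
  exact ContDiff.sum fun i _ => (contDiff_patchData_row l _ a i).mul
    (contDiff_matrix_adjugate hB i j)

/-! ## Decaying columns -/

lemma eventually_eval_ne_zero {p : ℂ[X]} (hp : p ≠ 0) :
    ∀ᶠ z in Bornology.cobounded ℂ, eval z p ≠ 0 := by
  have h : Bornology.IsBounded {z : ℂ | eval z p = 0} := by
    refine Set.Finite.isBounded ((p.roots.toFinset.finite_toSet).subset fun z hz => ?_)
    simpa [hp] using hz
  exact Bornology.isBounded_def.1 h

/-- A nonconstant polynomial is unbounded at infinity, and a constant tending to zero vanishes. -/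
lemma eq_zero_of_eval_isBigO_inv {p : ℂ[X]}
    (h : (fun z => eval z p) =O[Bornology.cobounded ℂ] fun z => z⁻¹) : p = 0 := by
  have h0 : Tendsto (fun z => eval z p) (Bornology.cobounded ℂ) (𝓝 0) :=
    h.trans_tendsto tendsto_inv₀_cobounded
  by_cases hd : 0 < p.degree
  · have h1 := p.tendsto_norm_atTop hd (tendsto_norm_cobounded_atTop (E := ℂ))
    exact absurd h0.norm (not_tendsto_nhds_of_tendsto_atTop h1 _)
  · rw [eq_C_of_degree_le_zero (not_lt.1 hd)] at h0 ⊢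
    simp only [eval_C] at h0
    rw [tendsto_nhds_unique h0 tendsto_const_nhds |>.symm]
    exact C_0

lemma det_map_eval {ι : Type*} [Fintype ι] [DecidableEq ι] (A : Matrix ι ι ℂ[X]) (z : ℂ) :
    (A.map (eval z)).det = eval z A.det :=
  (RingHom.map_det (evalRingHom z) A).symm

lemma mulVec_map_eval {ι κ : Type*} [Fintype κ] (A : Matrix ι κ ℂ[X]) (v : κ → ℂ[X]) (z : ℂ) :
    A.map (eval z) *ᵥ (fun b => (v b).eval z) = fun a => ((A *ᵥ v) a).eval z := by
  funext a
  exact (RingHom.map_mulVec (evalRingHom z) A v a).symm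

/-- The space of decaying columns. -/
def decaySub (D : PolyMat n k) : Submodule ℂ (Fin n → ℂ[X]) where
  carrier := {j | Decays D j}
  add_mem' {i j} hi hj a := by
    refine ((hi a).add (hj a)).congr_left fun z => ?_
    rw [← Pi.add_apply, ← Matrix.mulVec_add]
    simp only [Pi.add_def, eval_add]
  zero_mem' a := by
    simp only [Pi.zero_apply, eval_zero]
    exact (Asymptotics.isBigO_zero _ _).congr_left fun z =>
      (congrFun (Matrix.mulVec_zero (D.1.map (eval z))⁻¹) a).symm
  smul_mem' c j hj a := by
    refine ((hj a).const_mul_left c).congr_left fun z => ?_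
    rw [← smul_eq_mul, ← Pi.smul_apply, ← Matrix.mulVec_smul]
    simp only [Pi.smul_def, eval_smul]

lemma mem_decaySub {D : PolyMat n k} {j : Fin n → ℂ[X]} : j ∈ decaySub D ↔ Decays D j := Iff.rfl

/-- Here `D⁻¹ (D h) = h` is a polynomial vector that is `O(z⁻¹)`. -/
lemma eq_zero_of_decays_mulVec {D : PolyMat n k} {h : Fin n → ℂ[X]} (hd : Decays D (D.1 *ᵥ h)) :
    h = 0 := by
  funext a
  refine eq_zero_of_eval_isBigO_inv ((hd a).congr' ?_ EventuallyEq.rfl)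
  filter_upwards [eventually_eval_ne_zero D.det_ne_zero] with z hz
  rw [← mulVec_map_eval, Matrix.mulVec_mulVec, Matrix.nonsing_inv_mul, Matrix.one_mulVec]
  rw [det_map_eval]
  exact isUnit_iff_ne_zero.2 hz

/-- No nonzero decaying column lies in `D ℂ[X]^n`, so they inject into a quotient of dimension `k`.
The transpose turns columns into rows, for which codimension is known. -/
lemma finrank_decaySub_le (D : PolyMat n k) :
    Module.Finite ℂ (decaySub D) ∧ Module.finrank ℂ (decaySub D) ≤ k := by
  set D' : PolyMat n k := ⟨D.1ᵀ, by rw [Matrix.det_transpose]; exact D.2⟩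
  have hfin := finite_latQuot_of_det_ne_zero D'.1 D'.det_ne_zero
  have hrank : Module.finrank ℂ (LatQuot (latM D'.1)) = k := by
    obtain ⟨l, T, h, -⟩ := exists_latM_eq_patchMat D' _ (Or.inl rfl)
    rw [h, finrank_latQuot_patchMat]
  set F := (Submodule.mkQ ((latM D'.1).restrictScalars ℂ)).comp (decaySub D).subtype
  have hF : Function.Injective F := by
    rw [← LinearMap.ker_eq_bot, LinearMap.ker_eq_bot']
    rintro ⟨j, hj⟩ h0
    obtain ⟨g, hg⟩ := latQuot_mk_eq_zero.1 h0
    rw [Matrix.vecMulLinear_apply, Matrix.vecMul_transpose] at hg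
    change D.1 *ᵥ g = j at hg
    subst hg
    refine Subtype.ext ?_
    change D.1 *ᵥ g = 0
    rw [eq_zero_of_decays_mulVec hj, Matrix.mulVec_zero]
  exact ⟨Module.Finite.of_injective F hF, 
    (LinearMap.finrank_le_finrank_of_injective hF).trans hrank.le⟩

/-! ### The resolvent of `Z` at infinity and the columns of `J` -/

section Resolvent

attribute [local instance] Matrix.linftyOpNormedRing Matrix.linftyOpNormedAlgebra

lemma inv_apply_isBigO_inv (Z : Matrix (Fin k) (Fin k) ℂ) (i j : Fin k) :
    (fun z : ℂ => (z • (1 : Matrix (Fin k) (Fin k) ℂ) - Z)⁻¹ i j)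
      =O[Bornology.cobounded ℂ] fun z => z⁻¹ := by
  have h := spectrum.resolvent_isBigO_inv (𝕜 := ℂ) Z
  set L : Matrix (Fin k) (Fin k) ℂ →L[ℂ] ℂ :=
    LinearMap.toContinuousLinearMap (Matrix.entryLinearMap ℂ ℂ i j)
  refine ((L.isBigO_comp _ _).trans h).congr_left fun z => ?_
  change (Ring.inverse (algebraMap ℂ _ z - Z)) i j = _
  rw [← Matrix.nonsing_inv_eq_ringInverse, Algebra.algebraMap_eq_smul_one]

end Resolvent

lemma eventually_det_smul_one_sub_ne_zero (Z : Matrix (Fin k) (Fin k) ℂ) :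
    ∀ᶠ z in Bornology.cobounded ℂ, (z • (1 : Matrix (Fin k) (Fin k) ℂ) - Z).det ≠ 0 := by
  filter_upwards [eventually_eval_ne_zero Z.charpoly_monic.ne_zero] with z hz
  rwa [Matrix.eval_charpoly, Matrix.scalar_apply, ← Matrix.smul_one_eq_diagonal] at hz

/-- The combinations of the columns of a matrix. -/
def colComb (J : Matrix (Fin n) (Fin k) ℂ[X]) : (Fin k → ℂ) →ₗ[ℂ] (Fin n → ℂ[X]) :=
  Fintype.linearCombination ℂ J.col

lemma colComb_eq_mulVec (J : Matrix (Fin n) (Fin k) ℂ[X]) (c : Fin k → ℂ) :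
    colComb J c = J *ᵥ (fun i => C (c i)) := by
  funext a
  rw [colComb, Fintype.linearCombination_apply, Finset.sum_apply]
  refine Finset.sum_congr rfl fun i _ => ?_
  rw [Pi.smul_apply, smul_eq_C_mul, mul_comm]; rfl

lemma range_colComb (J : Matrix (Fin n) (Fin k) ℂ[X]) :
    LinearMap.range (colComb J) = Submodule.span ℂ (Set.range J.col) :=
  Fintype.range_linearCombination ℂ J.col

lemma linearIndependent_col_iff {J : Matrix (Fin n) (Fin k) ℂ[X]} :
    LinearIndependent ℂ J.col ↔ Function.Injective (colComb J) :=
  linearIndependent_iff_injective_fintypeLinearCombination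

lemma map_C_mulVec {m : ℕ} (A : Matrix (Fin m) (Fin k) ℂ) (c : Fin k → ℂ) :
    A.map C *ᵥ (fun i => (C (c i) : ℂ[X])) = fun i => C ((A *ᵥ c) i) := by
  funext a
  exact (RingHom.map_mulVec (C : ℂ →+* ℂ[X]) A c a).symm

lemma Rel.mulVec_eq {D : PolyMat n k} {J : Matrix (Fin n) (Fin k) ℂ[X]} {x : FreeData n k}
    (h : Rel D J x) (c : Fin k → ℂ) :
    D.1 *ᵥ (fun a => C ((x.1.2 *ᵥ c) a)) = (X : ℂ[X]) • colComb J c - colComb J (x.1.1 *ᵥ c) := by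
  have h1 := congrArg (fun A => A *ᵥ (fun i => (C (c i) : ℂ[X]))) h
  simp only [← Matrix.mulVec_mulVec] at h1
  rw [map_C_mulVec, Matrix.sub_mulVec, map_C_mulVec, Matrix.smul_mulVec, Matrix.one_mulVec,
    Matrix.mulVec_sub, Matrix.mulVec_smul] at h1
  rw [colComb_eq_mulVec J c, colComb_eq_mulVec J]
  exact h1

/-- For large `z` the relation reads `D⁻¹ J = Ψ (z - Z)⁻¹`, and the resolvent is `O(z⁻¹)`. -/
lemma Rel.decays {D : PolyMat n k} {J : Matrix (Fin n) (Fin k) ℂ[X]} {x : FreeData n k}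
    (h : Rel D J x) (i : Fin k) : Decays D (J.col i) := by
  intro a
  have h1 : (fun z : ℂ => (x.1.2 * (z • (1 : Matrix (Fin k) (Fin k) ℂ) - x.1.1)⁻¹) a i)
      =O[Bornology.cobounded ℂ] fun z => z⁻¹ := by
    simp only [Matrix.mul_apply]
    exact Asymptotics.IsBigO.fun_sum fun m _ => (inv_apply_isBigO_inv x.1.1 m i).const_mul_left _
  refine h1.congr' ?_ EventuallyEq.rfl
  filter_upwards [eventually_eval_ne_zero D.det_ne_zero,
    eventually_det_smul_one_sub_ne_zero x.1.1] with z hz hz'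
  have h2 : D.1.map (eval z) * x.1.2 = J.map (eval z) * (z • 1 - x.1.1) := by
    have h3 := congrArg (fun A : Matrix (Fin n) (Fin k) ℂ[X] => A.map (evalRingHom z)) h
    simp only [Matrix.map_mul] at h3
    have h5 : (x.1.2.map C).map (evalRingHom z) = x.1.2 := by ext; simp
    have h6 : ((X : ℂ[X]) • (1 : Matrix (Fin k) (Fin k) ℂ[X]) - x.1.1.map C).map
        (evalRingHom z) = z • 1 - x.1.1 := by
      ext i j
      by_cases hij : i = j <;> simp [hij]
    rw [h5, h6] at h3
    exact h3
  have hD : IsUnit (D.1.map (eval z)).det := by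
    rw [det_map_eval]; exact isUnit_iff_ne_zero.2 hz
  have h4 : x.1.2 * (z • (1 : Matrix (Fin k) (Fin k) ℂ) - x.1.1)⁻¹ =
      (D.1.map (eval z))⁻¹ * J.map (eval z) := by
    rw [← Matrix.nonsing_inv_mul_cancel_left (D.1.map (eval z)) x.1.2 hD, h2,
      ← Matrix.mul_assoc, Matrix.mul_nonsing_inv_cancel_right _ _ (isUnit_iff_ne_zero.2 hz')]
  rw [h4]; rfl

lemma eq_zero_of_forall_mulVec_eq_zero (x : FreeData n k) {c : Fin k → ℂ}
    (h : ∀ p : ℕ, (x.1.2 * x.1.1 ^ p) *ᵥ c = 0) : c = 0 := by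
  obtain ⟨l, hl⟩ := exists_frameMat_det_ne_zero x
  refine Matrix.eq_zero_of_mulVec_eq_zero hl (funext fun i => ?_)
  exact congrFun (h ((l.pos.symm i).2 : ℕ)) (l.pos.symm i).1

/-- If `J c = 0`, then `D Ψ c = -J Z c` decays, so `Ψ c = 0` and `J Z c = 0`. Iterating, `Ψ Z^p c =
0` for all `p`, whence `c = 0`. Thus `J` has `k` independent columns in a space of dimension at most
`k`. -/
theorem Rel.isFrame {D : PolyMat n k} {J : Matrix (Fin n) (Fin k) ℂ[X]} {x : FreeData n k}
    (h : Rel D J x) : IsFrame D J := by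
  have hle : LinearMap.range (colComb J) ≤ decaySub D := by
    rw [range_colComb, Submodule.span_le]
    rintro _ ⟨i, rfl⟩
    exact h.decays i
  have hstep : ∀ c, colComb J c = 0 → x.1.2 *ᵥ c = 0 ∧ colComb J (x.1.1 *ᵥ c) = 0 := by
    intro c hc
    have h1 := h.mulVec_eq c
    rw [hc, smul_zero, zero_sub] at h1
    have h2 : Decays D (D.1 *ᵥ fun a => C ((x.1.2 *ᵥ c) a)) := by
      rw [h1]; exact (decaySub D).neg_mem (hle ⟨_, rfl⟩)
    have h3 := eq_zero_of_decays_mulVec h2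
    refine ⟨funext fun a => C_injective ((congrFun h3 a).trans C_0.symm), ?_⟩
    rw [h3, Matrix.mulVec_zero] at h1
    exact neg_eq_zero.1 h1.symm
  have hinj : Function.Injective (colComb J) := by
    rw [← LinearMap.ker_eq_bot, LinearMap.ker_eq_bot']
    intro c hc
    have hpow : ∀ p : ℕ, colComb J ((x.1.1 ^ p) *ᵥ c) = 0 := by
      intro p
      induction p with
      | zero => simpa using hc
      | succ p ih => rw [pow_succ', ← Matrix.mulVec_mulVec]; exact (hstep _ ih).2
    refine eq_zero_of_forall_mulVec_eq_zero x fun p => ?_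
    rw [← Matrix.mulVec_mulVec]
    exact (hstep _ (hpow p)).1
  obtain ⟨hfin, hrank⟩ := finrank_decaySub_le D
  have heq : LinearMap.range (colComb J) = decaySub D := by
    refine Submodule.eq_of_le_of_finrank_le hle ?_
    rwa [LinearMap.finrank_range_of_inj hinj, Module.finrank_fin_fun]
  refine ⟨linearIndependent_col_iff.2 hinj, fun j => ?_⟩
  rw [← range_colComb, heq, mem_decaySub]

lemma exists_rel (D : PolyMat n k) : ∃ J x, Rel D J x := by
  obtain ⟨x, hx⟩ := Quotient.exists_rep (equivMA n k (ModM.mk D))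
  obtain ⟨J, hJ⟩ := equivMA_mk_eq_mk_iff.1 hx.symm
  exact ⟨J, x, hJ⟩

lemma exists_eq_mul_map_C {J J₀ : Matrix (Fin n) (Fin k) ℂ[X]}
    (h : Submodule.span ℂ (Set.range J.col) ≤ Submodule.span ℂ (Set.range J₀.col)) :
    ∃ G : Matrix (Fin k) (Fin k) ℂ, J = J₀ * G.map C := by
  have h1 : ∀ i, ∃ c, colComb J₀ c = J.col i := fun i => by
    have := h (Submodule.subset_span (mem_range_self i))
    rwa [← range_colComb] at this
  choose G hG using h1
  refine ⟨Matrix.of fun i j => G j i, Matrix.ext fun a i => ?_⟩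
  have := congrFun (hG i) a
  rw [colComb_eq_mulVec] at this
  exact this.symm

lemma eq_one_of_eq_mul_map_C {J : Matrix (Fin n) (Fin k) ℂ[X]}
    (hJ : Function.Injective (colComb J)) {G : Matrix (Fin k) (Fin k) ℂ}
    (h : J = J * G.map C) : G = 1 := by
  refine Matrix.ext_of_mulVec_single fun i => hJ ?_
  rw [Matrix.one_mulVec, colComb_eq_mulVec, ← map_C_mulVec, Matrix.mulVec_mulVec, ← h,
    ← colComb_eq_mulVec]

/-- Two frames differ by a constant invertible matrix, which acts as a gauge transformation. For two
solutions, `D (Ψ - Ψ') c = J (Z' - Z) c` decays, so both sides vanish. -/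
theorem IsFrame.existsUnique_rel {D : PolyMat n k} {J : Matrix (Fin n) (Fin k) ℂ[X]}
    (hJ : IsFrame D J) : ∃! x : FreeData n k, Rel D J x := by
  have hinj := linearIndependent_col_iff.1 hJ.1
  obtain ⟨J₀, x₀, h₀⟩ := exists_rel D
  have hspan : Submodule.span ℂ (Set.range J.col) = Submodule.span ℂ (Set.range J₀.col) := by
    ext j; rw [← hJ.2, ← h₀.isFrame.2]
  obtain ⟨G, hG⟩ := exists_eq_mul_map_C hspan.le
  obtain ⟨G', hG'⟩ := exists_eq_mul_map_C hspan.ge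
  have h1 : G' * G = 1 := by
    refine eq_one_of_eq_mul_map_C hinj ?_
    rw [Matrix.map_mul, ← Matrix.mul_assoc, ← hG', ← hG]
  set g : GL (Fin k) ℂ := ⟨G, G', mul_eq_one_comm.1 h1, h1⟩
  refine ⟨gaugeFree g x₀, ?_, ?_⟩
  · change Rel D J (gaugeFree g x₀)
    rw [hG]
    exact h₀.gauge (g := g) rfl
  · suffices huniq : ∀ x y : FreeData n k, Rel D J x → Rel D J y → x = y by
      intro y hy
      refine huniq _ _ hy ?_
      rw [hG]
      exact h₀.gauge (g := g) rfl
    intro x y hx hy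
    have hc : ∀ c, x.1.2 *ᵥ c = y.1.2 *ᵥ c ∧ x.1.1 *ᵥ c = y.1.1 *ᵥ c := by
      intro c
      have h2 : D.1 *ᵥ ((fun a => C ((x.1.2 *ᵥ c) a)) - fun a => C ((y.1.2 *ᵥ c) a)) =
          colComb J (y.1.1 *ᵥ c - x.1.1 *ᵥ c) := by
        rw [Matrix.mulVec_sub, hx.mulVec_eq, hy.mulVec_eq, map_sub]; abel
      have h3 : Decays D (D.1 *ᵥ ((fun a => C ((x.1.2 *ᵥ c) a)) -
          fun a => C ((y.1.2 *ᵥ c) a))) := by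
        rw [h2, hJ.2, ← range_colComb]; exact ⟨_, rfl⟩
      have h4 := eq_zero_of_decays_mulVec h3
      refine ⟨funext fun a => C_injective (congrFun (sub_eq_zero.1 h4) a), ?_⟩
      rw [h4, Matrix.mulVec_zero] at h2
      exact (sub_eq_zero.1 (hinj (h2.symm.trans (map_zero _).symm))).symm
    exact Subtype.ext (Prod.ext (Matrix.ext_of_mulVec_single fun i => (hc _).2)
      (Matrix.ext_of_mulVec_single fun i => (hc _).1))

/-! ## Triangular strata of `𝓜` -/

lemma triM_eq (l : Idx n k) : triM l =
    paramM l '' {T | ∀ a b, b < a → ∀ m, T a (l.pos ⟨b, m⟩) = 0} := by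
  ext y
  constructor
  · rintro ⟨D, ⟨P, hD, htri, hdeg⟩, rfl⟩
    set T : Coord n k := fun a i => (P a (l.pos.symm i).1).coeff (l.pos.symm i).2 with hT
    have hTP : ∀ a b m, T a (l.pos ⟨b, m⟩) = (P a b).coeff m := by
      intro a b m
      simp only [hT]
      rw [Equiv.symm_apply_apply]
    refine ⟨T, fun a b hba m => by rw [hTP, htri a b hba, coeff_zero], ?_⟩
    refine congrArg ModM.mk (Subtype.ext ?_)
    change patchMat l T = D.1
    rw [hD, patchMat]
    congr 1
    ext a b j
    rw [Matrix.of_apply, finsetSum_coeff]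
    simp only [hTP, coeff_C_mul_X_pow]
    by_cases hj : j < l.1 b
    · rw [Finset.sum_eq_single ⟨j, hj⟩]
      · simp
      · intro m _ hm
        rw [if_neg]
        rintro rfl
        exact hm rfl
      · simp
    · rw [(degree_lt_iff_coeff_zero _ _).1 (hdeg a b) j (not_lt.1 hj)]
      refine Finset.sum_eq_zero fun m _ => if_neg ?_
      have := m.2
      omega
  · rintro ⟨T, hT, rfl⟩
    refine ⟨_, ⟨_, rfl, fun a b hba => ?_, patchMat_sum_degree l T⟩, rfl⟩
    exact Finset.sum_eq_zero fun m _ => by rw [hT a b hba m, C_0, zero_mul]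

/-! ## Spans of rows -/

/-- The span of the rows with label in `S` of all the matrices `Ψ Z^p`. -/
def rowSpan (x : Data n k) (S : Finset (Fin n)) : Submodule ℂ (Fin k → ℂ) :=
  Submodule.span ℂ {v | ∃ b ∈ S, ∃ p : ℕ, v = (x.2 * x.1 ^ p) b}

lemma finrank_rowSpan_gaugeAct_le (g : GL (Fin k) ℂ) (x : Data n k) (S : Finset (Fin n)) :
    Module.finrank ℂ (rowSpan (gaugeAct g x) S) ≤ Module.finrank ℂ (rowSpan x S) := by
  have : rowSpan (gaugeAct g x) S ≤
      (rowSpan x S).map (Matrix.vecMulLinear (g : Matrix (Fin k) (Fin k) ℂ)) := by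
    refine Submodule.span_le.2 ?_
    rintro _ ⟨b, hb, p, rfl⟩
    refine ⟨_, Submodule.subset_span ⟨b, hb, p, rfl⟩, ?_⟩
    rw [gaugeAct_mul_pow]; rfl
  exact (Submodule.finrank_mono this).trans (Submodule.finrank_map_le _ _)

lemma finrank_rowSpan_eq_of_gEquiv {x y : FreeData n k} (h : GEquiv x y) (S : Finset (Fin n)) :
    Module.finrank ℂ (rowSpan x.1 S) = Module.finrank ℂ (rowSpan y.1 S) := by
  have key : ∀ {x y : FreeData n k}, GEquiv x y →
      Module.finrank ℂ (rowSpan y.1 S) ≤ Module.finrank ℂ (rowSpan x.1 S) := by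
    rintro x y ⟨g, hg⟩
    rw [hg]; exact finrank_rowSpan_gaugeAct_le g _ S
  exact le_antisymm (key ((gEquiv_equivalence n k).symm h)) (key h)

/-- If the rows of `T` with label in `S` are supported in the blocks with label in `S`, then the
rows with label in `S` span the sum of these blocks. -/
lemma finrank_rowSpan_patchData (l : Idx n k) (T : Coord n k) (S : Finset (Fin n))
    (hS : ∀ a ∈ S, ∀ b, b ∉ S → ∀ m, T a (l.pos ⟨b, m⟩) = 0) :
    Module.finrank ℂ (rowSpan (patchData l T) S) = ∑ b ∈ S, l.1 b := by
  set e : (Σ b : S, Fin (l.1 b)) → (Fin k → ℂ) := fun i => Pi.single (l.pos ⟨i.1, i.2⟩) 1 with he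
  have hli : LinearIndependent ℂ e := by
    have h1 := (Pi.basisFun ℂ (Fin k)).linearIndependent.comp
      (fun i : Σ b : S, Fin (l.1 b) => l.pos ⟨i.1, i.2⟩) (by
        rintro ⟨b, m⟩ ⟨b', m'⟩ h
        have h2 := l.pos.injective h
        rw [Sigma.mk.injEq] at h2
        obtain ⟨h3, h4⟩ := h2
        obtain rfl : b = b' := Subtype.ext h3
        exact congrArg _ (eq_of_heq h4))
    convert h1 using 1
    funext i
    rw [Function.comp_apply, Pi.basisFun_apply]
  have hstack : ∀ b ∈ S, ∀ p, stackRow l T b p ∈ Submodule.span ℂ (range e) := by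
    intro b hb p
    by_cases h : p < l.1 b
    · rw [stackRow, dif_pos h]
      exact Submodule.subset_span ⟨⟨⟨b, hb⟩, ⟨p, h⟩⟩, rfl⟩
    · rw [stackRow, dif_neg h, ← Finset.univ_sum_single (T b)]
      refine Submodule.sum_mem _ fun i _ => ?_
      obtain ⟨⟨c, m⟩, rfl⟩ := l.pos.surjective i
      by_cases hc : c ∈ S
      · rw [← mul_one (T b _), ← smul_eq_mul, Pi.single_smul]
        exact Submodule.smul_mem _ _ (Submodule.subset_span ⟨⟨⟨c, hc⟩, m⟩, rfl⟩)
      · rw [hS b hb c hc m, Pi.single_zero]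
        exact Submodule.zero_mem _
  have hspan : rowSpan (patchData l T) S = Submodule.span ℂ (range e) := by
    apply le_antisymm
    · refine Submodule.span_le.2 ?_
      rintro _ ⟨b, hb, p, rfl⟩
      change _ ∈ Submodule.span ℂ (range e)
      induction p with
      | zero =>
        rw [patchData_row l T b 0 (Nat.zero_le _)]
        exact hstack b hb 0
      | succ p ih =>
        -- The blocks in `S` are stable under `Z`: its rows there are stack rows with label in `S`.
        have hZ : Submodule.span ℂ (range e) ≤ (Submodule.span ℂ (range e)).comap
            (Matrix.vecMulLinear (patchData l T).1) := by
          refine Submodule.span_le.2 ?_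
          rintro _ ⟨⟨⟨c, hc⟩, m⟩, rfl⟩
          change Pi.single (l.pos ⟨c, m⟩) 1 ᵥ* (patchData l T).1 ∈ Submodule.span ℂ (range e)
          rw [Matrix.single_one_vecMul]
          change stackRow l T (l.pos.symm (l.pos ⟨c, m⟩)).1
            ((l.pos.symm (l.pos ⟨c, m⟩)).2 + 1) ∈ _
          rw [Equiv.symm_apply_apply]
          exact hstack c hc _
        have := hZ ih
        rw [pow_succ, ← Matrix.mul_assoc]
        exact this
    · refine Submodule.span_le.2 ?_
      rintro _ ⟨⟨⟨b, hb⟩, m⟩, rfl⟩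
      refine Submodule.subset_span ⟨b, hb, m, ?_⟩
      rw [patchData_row l T b m m.2.le, stackRow, dif_pos m.2]
  rw [hspan, finrank_span_eq_card hli, Fintype.card_sigma]
  simp only [Fintype.card_fin]
  exact Finset.sum_coe_sort S l.1

lemma finrank_rowSpan_of_mk_eq {x : FreeData n k} {l : Idx n k} {T : Coord n k}
    (h : ModA.mk x = paramA l T) (S : Finset (Fin n))
    (hS : ∀ a ∈ S, ∀ b, b ∉ S → ∀ m, T a (l.pos ⟨b, m⟩) = 0) :
    Module.finrank ℂ (rowSpan x.1 S) = ∑ b ∈ S, l.1 b := by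
  rw [finrank_rowSpan_eq_of_gEquiv (mk_eq_mk_iff.1 h), finrank_rowSpan_patchData l T S hS]

lemma iUnion_triM : (⋃ l : Idx n k, triM l) = Set.univ := by
  refine eq_univ_of_forall fun y => mem_iUnion.2 ?_
  obtain ⟨l, T, rfl, hT⟩ := exists_eq_paramM y _ (Or.inr rfl)
  refine ⟨l, ?_⟩
  rw [triM_eq]
  exact ⟨T, fun a b hba m => hT a b (not_le.2 hba) m, rfl⟩

/-- In `𝓜̃`, dimensions of row spans are orbit invariants. Upper triangular `T` makes final segments
of labels closed, so `l_a` is the difference for the segments `≥ a` and `> a`. -/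
lemma pairwise_disjoint_triM :
    Pairwise (fun l l' : Idx n k => Disjoint (triM l) (triM l')) := by
  intro l l' hne
  rw [Set.disjoint_left]
  intro y hy hy'
  rw [triM_eq] at hy hy'
  obtain ⟨T, hT, rfl⟩ := hy
  obtain ⟨T', hT', h⟩ := hy'
  have hA : paramA l T = paramA l' T' := by rw [← equivMA_paramM, ← equivMA_paramM, h]
  have key : ∀ S : Finset (Fin n), (∀ a ∈ S, ∀ b, b ∉ S → b < a) →
      ∑ b ∈ S, l.1 b = ∑ b ∈ S, l'.1 b := by
    intro S hS
    rw [← finrank_rowSpan_of_mk_eq (x := ⟨_, patchData_free l T⟩) rfl S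
      fun a ha b hb m => hT a b (hS a ha b hb) m,
      finrank_rowSpan_of_mk_eq hA S fun a ha b hb m => hT' a b (hS a ha b hb) m]
  refine hne (Subtype.ext (funext fun a => ?_))
  have h1 := key (Finset.Ici a) fun c hc b hb => by
    rw [Finset.mem_Ici] at *; exact (not_le.1 hb).trans_le hc
  have h2 := key (Finset.Ioi a) fun c hc b hb => by
    rw [Finset.mem_Ioi] at *; exact (not_lt.1 hb).trans_lt hc
  rw [← Finset.Ioi_insert, Finset.sum_insert (by simp),
    Finset.sum_insert (by simp), h2] at h1
  exact Nat.add_right_cancel h1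

/-! ## Triangular strata of `𝓜̃` -/

lemma flagSpan_eq (x : Data n k) (a : Fin n) : flagSpan x a = rowSpan x (Finset.Iio a) := by
  simp only [flagSpan, rowSpan, Finset.mem_Iio, Fin.lt_def]

lemma flagSpan_succ_eq (x : Data n k) (a : Fin n) :
    flagSpan x (a + 1) = rowSpan x (Finset.Iic a) := by
  simp only [flagSpan, rowSpan, Finset.mem_Iic, Fin.le_def, Nat.lt_succ_iff]

lemma finrank_flagSpan_succ {x : FreeData n k} {l : Idx n k} {T : Coord n k}
    (h : ModA.mk x = paramA l T) (hT : ∀ a b, a < b → ∀ m, T a (l.pos ⟨b, m⟩) = 0) (a : Fin n) :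
    Module.finrank ℂ (flagSpan x.1 (a + 1)) = Module.finrank ℂ (flagSpan x.1 a) + l.1 a := by
  rw [flagSpan_eq, flagSpan_succ_eq, finrank_rowSpan_of_mk_eq h, finrank_rowSpan_of_mk_eq h,
    ← Finset.Iio_insert, Finset.sum_insert (by simp), add_comm]
  · intro c hc b hb m
    rw [Finset.mem_Iio] at hc hb
    exact hT c b (hc.trans_le (not_lt.1 hb)) m
  · intro c hc b hb m
    rw [Finset.mem_Iic] at hc hb
    exact hT c b (hc.trans_lt (not_le.1 hb)) m

/-- Each class has a lower triangular normal form for some label, and the jumps of the flag recover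
that label. -/
lemma triA_eq (l : Idx n k) : triA l =
    paramA l '' {T | ∀ a b, a < b → ∀ m, T a (l.pos ⟨b, m⟩) = 0} := by
  ext y
  constructor
  · rintro ⟨x, hx, rfl⟩
    obtain ⟨l', T, h, hT⟩ := exists_eq_paramA (ModA.mk x) _ (Or.inl rfl)
    have hT' : ∀ a b, a < b → ∀ m, T a (l'.pos ⟨b, m⟩) = 0 :=
      fun a b hab m => hT a b (not_le.2 hab) m
    have hll : l = l' := by
      refine Subtype.ext (funext fun a => ?_)
      have := (hx a).symm.trans (finrank_flagSpan_succ h hT' a)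
      exact Nat.add_left_cancel this
    subst hll
    exact ⟨T, hT', h.symm⟩
  · rintro ⟨T, hT, rfl⟩
    exact ⟨_, finrank_flagSpan_succ rfl hT, rfl⟩

lemma iUnion_triA : (⋃ l : Idx n k, triA l) = Set.univ := by
  refine eq_univ_of_forall fun y => mem_iUnion.2 ?_
  obtain ⟨l, T, rfl, hT⟩ := exists_eq_paramA y _ (Or.inl rfl)
  refine ⟨l, ?_⟩
  rw [triA_eq]
  exact ⟨T, fun a b hab m => hT a b (not_le.2 hab) m, rfl⟩

lemma pairwise_disjoint_triA :
    Pairwise (fun l l' : Idx n k => Disjoint (triA l) (triA l')) := by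
  intro l l' hne
  rw [Set.disjoint_left]
  rintro y ⟨x, hx, rfl⟩ hy'
  rw [triA_eq] at hy'
  obtain ⟨T, hT, h⟩ := hy'
  refine hne (Subtype.ext (funext fun a => ?_))
  exact Nat.add_left_cancel ((hx a).symm.trans (finrank_flagSpan_succ h.symm hT a))

/-! ## The manifold structures -/

lemma frameMat_det_ne_zero_of_mem_range {l l' : Idx n k} {T : Coord n k}
    (h : paramA l T ∈ range (paramA l')) : (frameMat l' (patchData l T)).det ≠ 0 := by
  obtain ⟨T', hT'⟩ := h
  exact (mk_eq_paramA_iff.1 hT'.symm).1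

lemma paramA_coordOf_patchData {l l' : Idx n k} {T : Coord n k}
    (h : paramA l T ∈ range (paramA l')) :
    paramA l' (coordOf l' (patchData l T)) = paramA l T := by
  have h1 : ModA.mk ⟨patchData l T, patchData_free l T⟩ =
      paramA l' (coordOf l' (patchData l T)) :=
    mk_eq_paramA_iff.2 ⟨frameMat_det_ne_zero_of_mem_range h, rfl⟩
  exact h1.symm

lemma paramA_mem_range_of_paramM {l l' : Idx n k} {T : Coord n k}
    (h : paramM l T ∈ range (paramM l')) : paramA l T ∈ range (paramA l') := by
  obtain ⟨T', hT'⟩ := h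
  exact ⟨T', by rw [← equivMA_paramM, hT', equivMA_paramM]⟩

lemma isManifold_modA {c : ChartedSpace (Coord n k) (ModA n k)} (h : HasAtlas c paramA) :
    IsManifold 𝓘(ℂ, Coord n k) ω (ModA n k) :=
  isManifold_of_hasAtlas h (fun l l' T => coordOf l' (patchData l T))
    (fun l l' => (contDiffOn_coordOf_patchData l l').mono fun _ hT =>
      frameMat_det_ne_zero_of_mem_range hT)
    fun _ _ _ hT => paramA_coordOf_patchData hT

/-- The transition functions are those of `𝓜̃`, because the bijection matches the parametrizations.
-/
lemma isManifold_modM {c : ChartedSpace (Coord n k) (ModM n k)} (h : HasAtlas c paramM) :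
    IsManifold 𝓘(ℂ, Coord n k) ω (ModM n k) :=
  isManifold_of_hasAtlas h (fun l l' T => coordOf l' (patchData l T))
    (fun l l' => (contDiffOn_coordOf_patchData l l').mono fun _ hT =>
      frameMat_det_ne_zero_of_mem_range (paramA_mem_range_of_paramM hT))
    fun l l' T hT => (equivMA n k).injective <| by
      rw [equivMA_paramM, equivMA_paramM,
        paramA_coordOf_patchData (paramA_mem_range_of_paramM hT)]

lemma exists_paramM (m : ModM n k) : ∃ l T, m = paramM l T := by
  obtain ⟨l, T, h, -⟩ := exists_eq_paramM m _ (Or.inl rfl)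
  exact ⟨l, T, h⟩

lemma exists_paramA (y : ModA n k) : ∃ l T, y = paramA l T := by
  obtain ⟨l, T, h, -⟩ := exists_eq_paramA y _ (Or.inl rfl)
  exact ⟨l, T, h⟩

end HalfADHM

end

/-! ### The equivalence of the two moduli spaces -/

theorem mainTheorem2 (n k : ℕ) :
    (T2Space (HalfADHM.ModM n k) ∧ SecondCountableTopology (HalfADHM.ModM n k)) ∧
    (T2Space (HalfADHM.ModA n k) ∧ SecondCountableTopology (HalfADHM.ModA n k)) ∧
    -- the triangular strata of both spaces
    ((⋃ l : HalfADHM.Idx n k, HalfADHM.triM l) = Set.univ ∧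
      Pairwise (fun l l' : HalfADHM.Idx n k => Disjoint (HalfADHM.triM l) (HalfADHM.triM l')) ∧
      ∀ l : HalfADHM.Idx n k, HalfADHM.triM l =
        HalfADHM.paramM l '' {T | ∀ a b, b < a → ∀ m, T a (l.pos ⟨b, m⟩) = 0}) ∧
    ((⋃ l : HalfADHM.Idx n k, HalfADHM.triA l) = Set.univ ∧
      Pairwise (fun l l' : HalfADHM.Idx n k => Disjoint (HalfADHM.triA l) (HalfADHM.triA l')) ∧
      ∀ l : HalfADHM.Idx n k, HalfADHM.triA l =
        HalfADHM.paramA l '' {T | ∀ a b, a < b → ∀ m, T a (l.pos ⟨b, m⟩) = 0}) ∧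
    -- the complex manifold structures and the biholomorphic map
    ∃ (cM : ChartedSpace (HalfADHM.Coord n k) (HalfADHM.ModM n k))
      (cA : ChartedSpace (HalfADHM.Coord n k) (HalfADHM.ModA n k)),
      HalfADHM.HasAtlas cM HalfADHM.paramM ∧
      HalfADHM.HasAtlas cA HalfADHM.paramA ∧
      IsManifold 𝓘(ℂ, HalfADHM.Coord n k) ω (HalfADHM.ModM n k) ∧
      IsManifold 𝓘(ℂ, HalfADHM.Coord n k) ω (HalfADHM.ModA n k) ∧
      ∃ Φ : HalfADHM.ModM n k ≃ₘ^ω⟮𝓘(ℂ, HalfADHM.Coord n k), 𝓘(ℂ, HalfADHM.Coord n k)⟯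
          HalfADHM.ModA n k,
        -- the map is given by the half-ADHM relation
        (∀ (D : HalfADHM.PolyMat n k) (x : HalfADHM.FreeData n k),
          Φ (HalfADHM.ModM.mk D) = HalfADHM.ModA.mk x ↔ ∃ J, HalfADHM.Rel D J x) ∧
        (∀ (D : HalfADHM.PolyMat n k) (J : Matrix (Fin n) (Fin k) (Polynomial ℂ))
          (x : HalfADHM.FreeData n k), HalfADHM.Rel D J x → HalfADHM.IsFrame D J) ∧
        (∀ (D : HalfADHM.PolyMat n k) (J : Matrix (Fin n) (Fin k) (Polynomial ℂ)),
          HalfADHM.IsFrame D J → ∃! x : HalfADHM.FreeData n k, HalfADHM.Rel D J x) ∧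
        -- it is the only map given by the relation
        (∀ f : HalfADHM.ModM n k → HalfADHM.ModA n k,
          (∀ (D : HalfADHM.PolyMat n k) (x : HalfADHM.FreeData n k),
            f (HalfADHM.ModM.mk D) = HalfADHM.ModA.mk x → ∃ J, HalfADHM.Rel D J x) → f = Φ) ∧
        -- in corresponding charts it is the identity of the coordinates
        ∀ (l : HalfADHM.Idx n k) (T : HalfADHM.Coord n k),
          HalfADHM.Rel ⟨HalfADHM.patchMat l T, HalfADHM.patchMat_det_degree l T⟩
            (HalfADHM.patchJ l T) ⟨HalfADHM.patchData l T, HalfADHM.patchData_free l T⟩ ∧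
          Φ (HalfADHM.paramM l T) = HalfADHM.paramA l T := by
  obtain ⟨cM, hM⟩ := HalfADHM.exists_hasAtlas (n := n) (k := k)
    HalfADHM.isOpenEmbedding_paramM HalfADHM.exists_paramM
  obtain ⟨cA, hA⟩ := HalfADHM.exists_hasAtlas (n := n) (k := k)
    HalfADHM.isOpenEmbedding_paramA HalfADHM.exists_paramA
  have mM := HalfADHM.isManifold_modM hM
  have mA := HalfADHM.isManifold_modA hA
  refine ⟨⟨HalfADHM.t2Space_modM n k, HalfADHM.secondCountableTopology_modM n k⟩,
    ⟨HalfADHM.t2Space_modA n k, HalfADHM.secondCountableTopology_modA n k⟩,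
    ⟨HalfADHM.iUnion_triM, HalfADHM.pairwise_disjoint_triM, HalfADHM.triM_eq⟩,
    ⟨HalfADHM.iUnion_triA, HalfADHM.pairwise_disjoint_triA, HalfADHM.triA_eq⟩,
    cM, cA, hM, hA, mM, mA, ⟨HalfADHM.equivMA n k, ?_, ?_⟩, ?_⟩
  · exact HalfADHM.contMDiff_of_hasAtlas hM hA HalfADHM.exists_paramM _ HalfADHM.equivMA_paramM
  · refine HalfADHM.contMDiff_of_hasAtlas hA hM HalfADHM.exists_paramA _ fun l T => ?_
    rw [← HalfADHM.equivMA_paramM, Equiv.symm_apply_apply]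
  · refine ⟨fun D x => HalfADHM.equivMA_mk_eq_mk_iff, fun D J x h => h.isFrame,
      fun D J h => h.existsUnique_rel, fun f hf => funext fun m => ?_,
      fun l T => ⟨HalfADHM.rel_patch l T, HalfADHM.equivMA_paramM l T⟩⟩
    obtain ⟨D, rfl⟩ := Quotient.exists_rep m
    obtain ⟨x, hx⟩ := Quotient.exists_rep (f (HalfADHM.ModM.mk D))
    exact hx.symm.trans (HalfADHM.equivMA_mk_eq_mk_iff.2 (hf D x hx.symm)).symm
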